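/- Conventions. A *name* of a real number $x$ is a sequence $(x_n)_{n\in\mathbb N}$ of (notations of) rational numbers with $|x_n-x_{n+1}|\le 2^{-n}$ for all $n$ and $x_n\to x$. A real number is *computable* if it has a computable name. A function $g:[0,1]\to\mathbb R$ is *computable* if there is a Turing machine that transfers every name of every $x\in[0,1]$ to a name of $g(x)$; a function $f:[0,1]\to\mathbb R^2$ is computable if both of its components are. A *simple curve* is a set $C=\gamma([0,1])\subseteq\mathbb R^2$ with $\gamma:[0,1]\to\mathbb R^2$ continuous and injective. Its *length* $l(C)\in[0,\infty]$ is the length of $\gamma$, that is, the supremum of $\sum_{i<n}|\gamma(a_i)-\gamma(a_{i+1})|$ over all partitions $0=a_0<\dots<a_n=1$ (this does not depend on the choice of $\gamma$; a single point has length $0$), and $C$ is *rectifiable* if $l(C)<\infty$. For $z=(a,b)\in\mathbb R^2$ and $\varepsilon>0$ let $V_\varepsilon(z)$ be the open square bounded by the lines $x=a\pm\varepsilon$, $y=b\pm\varepsilon$; it is a *rational neighborhood* if $a,b,\varepsilon$ are rational. Put $V_\varepsilon(A)=\bigcup_{z\in A}V_\varepsilon(z)$ and $d_H(A,B)=\inf\{\varepsilon>0: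 A\subseteq V_\varepsilon(B)\text{ and }B\subseteq V_\varepsilon(A)\}$. A simple curve $C$ is called - *$K$-computable* if there is a computable sequence $(Q_n)_{n\in\mathbb N}$ of finite sets of rational neighborhoods such that $C\subseteq\bigcup Q_n$ and $d_H(\bigcup Q_n, C)<2^{-n}$ for all $n$; - *$R$-computable* if there is a computable function $f:[0,1]\to\mathbb R^2$ with range $C$; - *$M$-computable* if there is an injective computable function $f:[0,1]\to\mathbb R^2$ with range $C$; - *$N$-computable* if $C$ is rectifiable and there is a computable function $f:[0,1]\to\mathbb R^2$ with range $C$ such that the curve segment $f([0,t])$ has length $t\cdot l(C)$ for all $t\in[0,1]$. **Corollary.** Let $C\subseteq\mathbb R^2$ be a rectifiable simple curve whose length $l(C)$ is a computable real number. Then the following are equivalent: $C$ is $K$-computable; $C$ is $R$-computable; $C$ is $M$-computable; $C$ is $N$-computable. -/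

import Mathlib

open Filter Topology Set
open scoped ENNReal unitInterval

noncomputable section

namespace CompCurve

/-- The Euclidean plane. -/
abbrev Plane : Type := EuclideanSpace ℝ (Fin 2)

/-! ### Curves and their length -/

/-- `γ` is an injective continuous parametrization of `C` over `[0,1]`. -/
def IsInjParam (γ : I → Plane) (C : Set Plane) : Prop :=
  Continuous γ ∧ Function.Injective γ ∧ range γ = C

/-- Simple (open) curves, also called Jordan arcs. -/
def IsSimpleCurve (C : Set Plane) : Prop :=
  ∃ γ : I → Plane, IsInjParam γ C

/-- The length of a parametrization: the supremum of the lengths of the inscribed polygons. -/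
def paramLength (γ : I → Plane) : ℝ≥0∞ := eVariationOn γ univ

/-- The length `l(C)` of a simple curve `C` is the length of an injective parametrization of `C`.
All injective parametrizations of `C` have the same length, and the supremum names this common
value. A one-point set, which is no simple curve, gets the length `0`. -/
def curveLength (C : Set Plane) : ℝ≥0∞ :=
  ⨆ (γ : I → Plane) (_ : IsInjParam γ C), paramLength γ

/-- A curve is rectifiable if its length is finite. -/
def IsRectifiable (C : Set Plane) : Prop := curveLength C < ⊤

/-! ### Names of real numbers and computable real functions -/

/-- Notations of rational numbers: `(a, b)` denotes the fraction `a / (b + 1)`. -/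
abbrev RatCode : Type := ℤ × ℕ

/-- The rational number denoted by a code, as a real number. -/
def RatCode.val (p : RatCode) : ℝ := (p.1 : ℝ) / ((p.2 : ℝ) + 1)

/-- A name of the real number `x` is a sequence of rationals that converges effectively to `x`:
consecutive terms satisfy `|x_n - x_{n+1}| ≤ 2^{-n}`. -/
def IsName (φ : ℕ → RatCode) (x : ℝ) : Prop :=
  (∀ n, |(φ n).val - (φ (n + 1)).val| ≤ (1 / 2 : ℝ) ^ n) ∧
    Tendsto (fun n => (φ n).val) atTop (𝓝 x)

/-- A real number is computable if it has a computable name. -/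
def IsComputableReal (x : ℝ) : Prop :=
  ∃ φ : ℕ → RatCode, Computable φ ∧ IsName φ x

/-- A Turing machine that works on infinite sequences of rationals is described by the function `M`
which tells, for a finite initial segment `w` of the input sequence and a number `n`, the `n`-th
term of the output sequence if the machine has written it within `w.length` steps, during which it
can only have read terms of `w`; the value is `none` if that term has not been written yet.
`Transfers M φ ψ`: on the input sequence `φ` the machine writes the output sequence `ψ`. -/
def Transfers (M : List RatCode → ℕ → Option RatCode) (φ ψ : ℕ → RatCode) : Prop :=
  ∀ n, (∃ k, M ((List.range k).map φ) n = some (ψ n)) ∧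
    ∀ k q, M ((List.range k).map φ) n = some q → q = ψ n

/-- A function `g : [0,1] → ℝ` is computable if there is a machine which transfers every name of
every `x ∈ [0,1]` to a name of `g x`. -/
def IsComputableFun (g : I → ℝ) : Prop :=
  ∃ M : List RatCode → ℕ → Option RatCode, Computable₂ M ∧
    ∀ (x : I) (φ : ℕ → RatCode), IsName φ (x : ℝ) →
      ∃ ψ : ℕ → RatCode, IsName ψ (g x) ∧ Transfers M φ ψ

/-- A function from `[0,1]` to the plane is computable if its components are. -/
def IsComputablePath (f : I → Plane) : Prop :=
  ∀ i : Fin 2, IsComputableFun (fun t => f t i)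

/-! ### Rational neighborhoods and the Hausdorff distance -/

/-- The `ε`-neighborhood of the point `z`: the open square bounded by the lines `x = z₀ ± ε` and
`y = z₁ ± ε`. -/
def nbhd (ε : ℝ) (z : Plane) : Set Plane :=
  {w | |w 0 - z 0| < ε ∧ |w 1 - z 1| < ε}

/-- The `ε`-neighborhood of a set. -/
def nbhdSet (ε : ℝ) (A : Set Plane) : Set Plane := ⋃ z ∈ A, nbhd ε z

/-- The Hausdorff distance, `inf {ε | A ⊆ V_ε(B) and B ⊆ V_ε(A)}`, with the value `∞` if there is
no such `ε`. -/
def dH (A B : Set Plane) : ℝ≥0∞ :=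
  ⨅ (ε : ℝ) (_ : 0 < ε ∧ A ⊆ nbhdSet ε B ∧ B ⊆ nbhdSet ε A), ENNReal.ofReal ε

/-- Codes of rational neighborhoods: `((a, b), r)` stands for center `(a, b)` and size `r`. -/
abbrev NbhdCode : Type := (RatCode × RatCode) × RatCode

/-- The rational neighborhood given by a code. -/
def NbhdCode.toSet (U : NbhdCode) : Set Plane :=
  nbhd (RatCode.val U.2) !₂[RatCode.val U.1.1, RatCode.val U.1.2]

/-- The union `⋃ Q` of a finite set `Q` of rational neighborhoods, given as a list of codes. -/
def coverUnion (Q : List NbhdCode) : Set Plane := ⋃ U ∈ Q, NbhdCode.toSet U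

/-! ### The four kinds of computable curves -/

/-- `K`-computability: computable sequences of compact covers. -/
def KComputable (C : Set Plane) : Prop :=
  ∃ Q : ℕ → List NbhdCode, Computable Q ∧
    ∀ n, (∀ U ∈ Q n, 0 < RatCode.val U.2) ∧ C ⊆ coverUnion (Q n) ∧
      dH (coverUnion (Q n)) C < ENNReal.ofReal ((1 / 2 : ℝ) ^ n)

/-- `R`-computability: a computable, possibly retracing, parametrization. -/
def RComputable (C : Set Plane) : Prop :=
  ∃ f : I → Plane, IsComputablePath f ∧ range f = C

/-- `M`-computability: an injective computable parametrization. -/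
def MComputable (C : Set Plane) : Prop :=
  ∃ f : I → Plane, IsComputablePath f ∧ Function.Injective f ∧ range f = C

/-- `N`-computability: a length-normalized computable parametrization, that is, the length of the
curve segment `f([0,t])` is `t * l(C)` for all `t ∈ [0,1]`, where `l(C)` is finite. -/
def NComputable (C : Set Plane) : Prop :=
  IsRectifiable C ∧ ∃ f : I → Plane, IsComputablePath f ∧ range f = C ∧
    ∀ t : I, curveLength (f '' Iic t) = ENNReal.ofReal (t : ℝ) * curveLength C

end CompCurve

end

noncomputable section

namespace CompCurve

/-! ### Injective parametrizations and arc length -/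

/-! The only hard implication starts from K-computability: it yields computability of the arc length
parametrization `F`, which witnesses M- and N-computability at once. These trivially give
R-computability, and R gives K by a compactness argument.

The core is a rigidity fact, `IsArcParam.unique`: a map with Lipschitz constant `L`, the length of
`C`, that covers `C` has no slack to retrace anything, so it is `F` or its reversal; knowing that it
does not start at `F 1` leaves only `F`. On the lattice of mesh `2 ^ (-m)` this is imitated by
traces: finite sequences of lattice points that stay near the cover, come close to all of it, start
in the right place and obey the Lipschitz bound up to rounding. Ultrafilter limits of traces are
Lipschitz coverings of `C`, hence equal `F`; so for large `m` all traces are uniformly close to `F`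
(`TraceData.eventually_dist_le`).

No rate of convergence is known, but none is needed. Traces on a fixed lattice form a finite
decidable set, so one can search for a lattice and a trace to which all traces there are `2 ^
(-n)`-close. The search succeeds, and its result is close to `F` because `F` rounded to the lattice
is itself a trace. Computability of the length enters through the integer bounds `ℓ m` for `L * 2 ^
m`.

For R to K, the binary tree of dyadic names is compact, so a machine answers on all of them within a
bounded number of steps (`eventually_exists_isSome`). Finitely many answers then give the centers of
small squares that cover the curve. -/

theorem IsInjParam.continuous_symm_comp {F : I → Plane} {C : Set Plane} (hF : IsInjParam F C)
    {X : Type*} [TopologicalSpace X] {G : X → Plane} (hG : Continuous G) (hGC : range G ⊆ C) :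
    ∃ h : X → I, Continuous h ∧ ∀ x, F (h x) = G x := by
  have hemb : IsClosedEmbedding F := hF.1.isClosedEmbedding hF.2.1
  have hex : ∀ x, ∃ t, F t = G x := fun x => by
    have : G x ∈ range F := hF.2.2 ▸ hGC ⟨x, rfl⟩
    exact this
  choose h hh using hex
  refine ⟨h, ?_, hh⟩
  rw [hemb.isInducing.continuous_iff]
  convert hG
  exact funext hh

/-- The change of parameter is continuous and injective on an interval, hence strictly monotone, and
monotone substitutions do not increase variation. By symmetry, one inequality suffices. -/
theorem IsInjParam.paramLength_le {γ γ' : I → Plane} {C : Set Plane} (h : IsInjParam γ C)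
    (h' : IsInjParam γ' C) : paramLength γ ≤ paramLength γ' := by
  obtain ⟨φ, hφ, hφγ⟩ := h'.continuous_symm_comp h.1 h.2.2.le
  have hinj : Function.Injective φ := fun s t hst => h.2.1 (by rw [← hφγ, ← hφγ, hst])
  have hγ : γ = γ' ∘ φ := funext fun x => (hφγ x).symm
  rw [hγ]
  rcases hφ.strictMono_of_inj hinj with hm | hm
  · exact eVariationOn.comp_le_of_monotoneOn γ' φ (hm.monotone.monotoneOn _) (mapsTo_univ _ _)
  · exact eVariationOn.comp_le_of_antitoneOn γ' φ (hm.antitone.antitoneOn _) (mapsTo_univ _ _)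

theorem IsInjParam.curveLength_eq {γ : I → Plane} {C : Set Plane} (h : IsInjParam γ C) :
    curveLength C = paramLength γ :=
  le_antisymm (iSup₂_le fun _ h' => h'.paramLength_le h) (le_iSup₂_of_le γ h le_rfl)

theorem curveLength_singleton (z : Plane) : curveLength {z} = 0 := by
  refine le_antisymm (iSup₂_le fun γ h => ?_) (zero_le)
  have h0 : γ 0 ∈ ({z} : Set Plane) := h.2.2 ▸ ⟨0, rfl⟩
  have h1 : γ 1 ∈ ({z} : Set Plane) := h.2.2 ▸ ⟨1, rfl⟩
  exact absurd (h.2.1 (h0.trans h1.symm)) zero_ne_one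

/-- `F` is an injective parametrization of `C` by arc length, scaled to `[0,1]`. -/
structure IsArcParam (F : I → Plane) (C : Set Plane) (L : ℝ) : Prop where
  inj : IsInjParam F C
  pos : 0 < L
  variation : ∀ s t : I, s ≤ t → eVariationOn F (Icc s t) = ENNReal.ofReal (L * (t - s))

/-- The variation of `γ` from `0`, divided by `L`, is an order isomorphism of the unit interval:
injectivity of `γ` makes it strictly increasing and continuity of `γ` makes it continuous. Composing
`γ` with its inverse gives `F`. -/
theorem exists_isArcParam {C : Set Plane} (hC : IsSimpleCurve C) (hr : IsRectifiable C) :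
    ∃ F, IsArcParam F C (curveLength C).toReal := by
  obtain ⟨γ, hγ⟩ := hC
  have hlen := hγ.curveLength_eq
  have hbv : BoundedVariationOn γ univ := by
    have : curveLength C < ⊤ := hr
    rw [hlen] at this
    exact this.ne
  have hlb := hbv.locallyBoundedVariationOn
  set L := (curveLength C).toReal with hL
  set v : I → ℝ := variationOnFromTo γ univ 0 with hv
  have hv0 : v 0 = 0 := variationOnFromTo.self _ _ _
  have hv1 : v 1 = L := by
    rw [hv, variationOnFromTo.eq_of_le _ _ (zero_le_one : (0 : I) ≤ 1), hL, hlen, paramLength]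
    congr 2
    ext x; simp [unitInterval.le_one']
  have hvsub : ∀ s t : I, s ≤ t → v t - v s = (eVariationOn γ (Icc s t)).toReal := by
    intro s t hst
    rw [hv, variationOnFromTo.sub_right hlb (mem_univ _) (mem_univ _) (mem_univ _),
      variationOnFromTo.eq_of_le _ _ hst, univ_inter]
  have hmono : StrictMono v := by
    intro s t hst
    have h1 := hvsub s t hst.le
    have h2 : 0 < (eVariationOn γ (Icc s t)).toReal := by
      refine ENNReal.toReal_pos (fun h0 => ?_) (hbv.mono (subset_univ _))
      rw [eVariationOn.eq_zero_iff] at h0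
      have := h0 s (left_mem_Icc.2 hst.le) t (right_mem_Icc.2 hst.le)
      exact hst.ne (hγ.2.1 (edist_eq_zero.1 this))
    linarith
  have hLpos : 0 < L := by
    rw [← hv1, ← hv0]; exact hmono zero_lt_one
  have hcont : Continuous v := by
    rw [continuous_iff_continuousAt]
    intro x
    rw [continuousAt_iff_continuous_left'_right']
    have hx : ContinuousAt γ x := hγ.1.continuousAt
    constructor
    · have := variationOnFromTo.tendsto_left (s := univ) (l := γ x) (mem_univ (0 : I)) (mem_univ x)
        hlb (hx.tendsto.mono_left nhdsWithin_le_nhds)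
      simpa [ContinuousWithinAt] using this
    · have := variationOnFromTo.tendsto_right (s := univ) (l := γ x) (mem_univ (0 : I)) (mem_univ x)
        hlb (hx.tendsto.mono_left nhdsWithin_le_nhds)
      simpa [ContinuousWithinAt] using this
  have hvmem : ∀ t, v t / L ∈ I := fun t => by
    constructor
    · exact div_nonneg (hv0 ▸ hmono.monotone t.2.1) hLpos.le
    · rw [div_le_one hLpos, ← hv1]; exact hmono.monotone t.2.2
  let φ : I → I := fun t => ⟨v t / L, hvmem t⟩
  have hφm : StrictMono φ := fun s t hst =>
    Subtype.mk_lt_mk.2 (div_lt_div_of_pos_right (hmono hst) hLpos)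
  have hφc : Continuous φ := Continuous.subtype_mk (hcont.div_const L) _
  have hφs : Function.Surjective φ := by
    intro y
    have h0 : φ 0 = 0 := Subtype.ext (by simp [φ, hv0])
    have h1 : φ 1 = 1 := Subtype.ext (by simp [φ, hv1, hLpos.ne'])
    have := intermediate_value_univ (0 : I) 1 hφc
    rw [h0, h1] at this
    exact this ⟨y.2.1, y.2.2⟩
  let e : I ≃o I := hφm.orderIsoOfSurjective φ hφs
  have hev : ∀ t, v (e.symm t) = L * t := by
    intro t
    have h1 : φ (e.symm t) = t := e.apply_symm_apply t
    have h2 : v (e.symm t) / L = t := congrArg Subtype.val h1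
    rw [← h2]; field_simp
  refine ⟨γ ∘ e.symm, ⟨hγ.1.comp e.symm.continuous, hγ.2.1.comp e.symm.injective, ?_⟩, hLpos, ?_⟩
  · rw [e.symm.surjective.range_comp, hγ.2.2]
  · intro s t hst
    rw [eVariationOn.comp_eq_of_monotoneOn _ _ (e.symm.monotone.monotoneOn _), e.symm.image_Icc,
      mul_sub, ← hev, ← hev, hvsub _ _ (e.symm.monotone hst),
      ENNReal.ofReal_toReal (hbv.mono (subset_univ _))]

namespace IsArcParam

variable {F : I → Plane} {C : Set Plane} {L : ℝ}

theorem dist_le (h : IsArcParam F C L) (s t : I) : dist (F s) (F t) ≤ L * |(s : ℝ) - t| := by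
  wlog hst : s ≤ t generalizing s t
  · rw [dist_comm, abs_sub_comm]; exact this t s (le_of_not_ge hst)
  have h0 : (0 : ℝ) ≤ t - s := sub_nonneg.2 hst
  have := eVariationOn.edist_le F (left_mem_Icc.2 hst) (right_mem_Icc.2 hst)
  rw [h.variation s t hst, edist_dist, ENNReal.ofReal_le_ofReal_iff (mul_nonneg h.pos.le h0)] at this
  rwa [abs_sub_comm, abs_of_nonneg h0]

theorem curveLength_eq (h : IsArcParam F C L) : curveLength C = ENNReal.ofReal L := by
  rw [h.inj.curveLength_eq, paramLength, ← univ_inter univ]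
  have := h.variation 0 1 zero_le_one
  have h2 : (univ : Set I) = Icc 0 1 := by ext x; simp [unitInterval.le_one']
  rw [univ_inter, h2, this]; simp

theorem curveLength_image_Iic (h : IsArcParam F C L) (t : I) :
    curveLength (F '' Iic t) = ENNReal.ofReal (t : ℝ) * curveLength C := by
  rw [h.curveLength_eq, ← ENNReal.ofReal_mul t.2.1]
  have hIic : Iic t = Icc 0 t := by ext x; simp
  -- Rescaling by `t` is injective only for `t > 0`; at `t = 0` the segment is a point, whose length
  -- is the empty supremum.
  rcases eq_or_lt_of_le t.2.1 with h0 | h0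
  · have ht : t = 0 := Subtype.ext h0.symm
    subst ht
    rw [hIic, Icc_self, image_singleton, curveLength_singleton]; simp
  · let φ : I → I := fun u => u * t
    have hφm : Monotone φ := fun a b hab =>
      Subtype.mk_le_mk.2 (mul_le_mul_of_nonneg_right (Subtype.coe_le_coe.2 hab) t.2.1)
    have hφi : Function.Injective φ := fun a b hab => by
      have := congrArg Subtype.val hab
      exact Subtype.ext (mul_right_cancel₀ h0.ne' this)
    have hφr : range φ = Icc 0 t := by
      ext x
      constructor
      · rintro ⟨u, rfl⟩
        exact ⟨(u * t).2.1, Subtype.coe_le_coe.1 (mul_le_of_le_one_left t.2.1 u.2.2)⟩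
      · rintro ⟨hx0, hx1⟩
        refine ⟨⟨(x : ℝ) / t, div_nonneg x.2.1 t.2.1, (div_le_one h0).2 hx1⟩, Subtype.ext ?_⟩
        exact div_mul_cancel₀ _ h0.ne'
    have hp : IsInjParam (F ∘ φ) (F '' Iic t) := by
      refine ⟨h.inj.1.comp (by fun_prop), h.inj.2.1.comp hφi, ?_⟩
      rw [range_comp, hφr, hIic]
    rw [hp.curveLength_eq, paramLength, eVariationOn.comp_eq_of_monotoneOn _ _ (hφm.monotoneOn _),
      image_univ, hφr, h.variation 0 t t.2.1]
    simp [mul_comm]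

end IsArcParam

/-- A path that covers a rectifiable arc is at least as long on every interval as the
arc between the points reached at the ends of the interval. -/
theorem eVariationOn_le_comp {E : Type*} [PseudoEMetricSpace E] {F : I → E} {h : I → I}
    (hc : Continuous h) {s t : I} (hst : s ≤ t) :
    eVariationOn F (Icc (h s) (h t)) ≤ eVariationOn (F ∘ h) (Icc s t) := by
  -- `r u` is the first time at which `h` reaches `u`. First hitting times increase with `u` by the
  -- intermediate value theorem, so `F` is `F ∘ h` sampled monotonically.
  have hne : ∀ u ∈ Icc (h s) (h t), ∃ r ∈ Icc s t, h r = u ∧ ∀ r' ∈ Icc s t, h r' = u → r ≤ r' := by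
    intro u hu
    have hK : IsCompact (Icc s t ∩ h ⁻¹' {u}) :=
      isCompact_Icc.inter_right (isClosed_singleton.preimage hc)
    obtain ⟨r0, hr0, hr0'⟩ := intermediate_value_Icc hst hc.continuousOn hu
    obtain ⟨r, hr, hmin⟩ := hK.exists_isLeast ⟨r0, hr0, hr0'⟩
    exact ⟨r, hr.1, hr.2, fun r' h1 h2 => hmin ⟨h1, h2⟩⟩
  choose! r hr1 hr2 hr3 using hne
  have hmono : MonotoneOn r (Icc (h s) (h t)) := by
    intro u hu w hw huw
    have hsub : Icc (h s) (h (r w)) ⊆ h '' Icc s (r w) :=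
      intermediate_value_Icc (hr1 w hw).1 hc.continuousOn
    obtain ⟨q, hq, hqu⟩ := hsub ⟨hu.1, by rw [hr2 w hw]; exact huw⟩
    exact (hr3 u hu q ⟨hq.1, hq.2.trans (hr1 w hw).2⟩ hqu).trans hq.2
  calc eVariationOn F (Icc (h s) (h t)) = eVariationOn ((F ∘ h) ∘ r) (Icc (h s) (h t)) :=
        eVariationOn.congr fun u hu => by simp [hr2 u hu]
    _ ≤ _ := eVariationOn.comp_le_of_monotoneOn _ r hmono hr1

theorem eVariationOn_Icc_le_of_dist_le {E : Type*} [PseudoMetricSpace E] {G : I → E} {L : ℝ}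
    (hL : 0 ≤ L) (hG : ∀ s t, dist (G s) (G t) ≤ L * |(s : ℝ) - t|) (s t : I) :
    eVariationOn G (Icc s t) ≤ ENNReal.ofReal (L * (t - s)) := by
  have h1 : LipschitzWith L.toNNReal G := LipschitzWith.of_dist_le_mul fun x y => by
    rw [Real.coe_toNNReal L hL]; exact hG x y
  have h2 := h1.lipschitzOnWith (s := univ) |>.comp_eVariationOn_le (g := (id : I → I))
    (s := Icc s t) (mapsTo_univ _ _)
  have h3 : eVariationOn (id : I → I) (Icc s t) ≤ ENNReal.ofReal (t - s) := by
    have h4 : Monotone (Subtype.val : I → ℝ) := fun _ _ h => h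
    have h5 := ((h4.monotoneOn univ).eVariationOn_eq (mem_univ s) (mem_univ t)).le
    rw [univ_inter] at h5
    exact h5
  rw [Function.comp_id] at h2
  refine h2.trans ?_
  rw [ENNReal.ofReal_mul hL]
  exact mul_le_mul_right h3 _

/-- Preimages of `0` and `1` must lie at distance `1`, so they are the end points; `h 0 ≠ 1`
excludes the reversal. Comparing with both ends gives `h t ≤ t` and `1 - h t ≤ 1 - t`. -/
theorem eq_id_of_dist_le {h : I → I} (hs : Function.Surjective h)
    (hd : ∀ s t, |(h s : ℝ) - h t| ≤ |(s : ℝ) - t|) (h0 : h 0 ≠ 1) : ∀ t, h t = t := by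
  obtain ⟨a, ha⟩ := hs 0
  obtain ⟨b, hb⟩ := hs 1
  have hab := hd a b
  rw [ha, hb] at hab
  have ha0 := a.2.1
  have ha1 := a.2.2
  have hb0 := b.2.1
  have hb1 := b.2.2
  have hcase : (a = 0 ∧ b = 1) ∨ b = 0 := by
    simp only [Icc.coe_zero, Icc.coe_one, zero_sub, abs_neg, abs_one] at hab
    rcases le_abs.1 hab with h | h
    · right; exact Subtype.ext (show (b : ℝ) = 0 by linarith)
    · left; exact ⟨Subtype.ext (show (a : ℝ) = 0 by linarith), Subtype.ext (show (b : ℝ) = 1 by linarith)⟩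
  rcases hcase with ⟨rfl, rfl⟩ | rfl
  · intro t
    have h1 := hd t 0
    have h2 := hd 1 t
    rw [ha] at h1
    rw [hb] at h2
    have ht0 := t.2.1
    have ht1 := t.2.2
    have hh0 := (h t).2.1
    have hh1 := (h t).2.2
    simp only [Icc.coe_zero, Icc.coe_one, sub_zero] at h1 h2
    rw [abs_of_nonneg hh0, abs_of_nonneg ht0] at h1
    rw [abs_of_nonneg (by linarith), abs_of_nonneg (by linarith)] at h2
    exact Subtype.ext (by linarith)
  · exact absurd hb h0

/-- Write `G = F ∘ h`. Arc length along `F` is at most the variation of `G`, which the Lipschitz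
bound controls, so `h` is a 1-Lipschitz surjection of the interval. -/
theorem IsArcParam.unique {F : I → Plane} {C : Set Plane} {L : ℝ} (hF : IsArcParam F C L)
    {G : I → Plane} (hG : ∀ s t, dist (G s) (G t) ≤ L * |(s : ℝ) - t|) (hr : range G = C)
    (h0 : G 0 ≠ F 1) : G = F := by
  have hGc : Continuous G :=
    (LipschitzWith.of_dist_le_mul (K := L.toNNReal) fun x y => by
      rw [Real.coe_toNNReal L hF.pos.le]; exact hG x y).continuous
  obtain ⟨h, hc, hFh⟩ := hF.inj.continuous_symm_comp hGc hr.le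
  have hGF : G = F ∘ h := funext fun x => (hFh x).symm
  have hsurj : Function.Surjective h := by
    intro t
    have : F t ∈ range G := by rw [hr, ← hF.inj.2.2]; exact ⟨t, rfl⟩
    obtain ⟨x, hx⟩ := this
    exact ⟨x, hF.inj.2.1 (by rw [hFh, hx])⟩
  have key : ∀ f : I → I, Continuous f → (∀ s t, dist (F (f s)) (F (f t)) ≤ L * |(s : ℝ) - t|) →
      ∀ s t : I, s ≤ t → f s ≤ f t → (f t : ℝ) - f s ≤ t - s := by
    intro f hfc hf s t hst hfst
    have h1 := eVariationOn_le_comp (F := F) hfc hst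
    have h2 := h1.trans (eVariationOn_Icc_le_of_dist_le hF.pos.le hf s t)
    rw [hF.variation _ _ hfst, ENNReal.ofReal_le_ofReal_iff
      (mul_nonneg hF.pos.le (sub_nonneg.2 hst))] at h2
    exact le_of_mul_le_mul_left h2 hF.pos
  have hdist : ∀ s t, dist (F (h s)) (F (h t)) ≤ L * |(s : ℝ) - t| := fun s t => by
    rw [hFh, hFh]; exact hG s t
  have hone : ∀ s t : I, s ≤ t → |(h s : ℝ) - h t| ≤ |(s : ℝ) - t| := by
    intro s t hst
    have hst' : (s : ℝ) ≤ t := hst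
    rw [abs_sub_comm (s : ℝ), abs_of_nonneg (sub_nonneg.2 hst')]
    rcases le_total (h s) (h t) with hle | hle
    · have hle' : (h s : ℝ) ≤ h t := hle
      rw [abs_sub_comm, abs_of_nonneg (sub_nonneg.2 hle')]
      exact key h hc hdist s t hst hle
    · have hle' : (h t : ℝ) ≤ h s := hle
      rw [abs_of_nonneg (sub_nonneg.2 hle')]
      -- Where `h` goes backwards, reverse time; this is why `key` is stated for a general `f`.
      have := key (fun x => h (σ x)) (by fun_prop) (fun x y => by
        refine (hdist _ _).trans_eq ?_
        simp only [unitInterval.coe_symm_eq]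
        rw [abs_sub_comm (x : ℝ)]; congr 2; ring) (σ t) (σ s)
        (unitInterval.symm_le_symm.2 hst) (by simpa using hle)
      simpa using this
  have hid := eq_id_of_dist_le hsurj (fun s t => by
    rcases le_total s t with hst | hst
    · exact hone s t hst
    · rw [abs_sub_comm, abs_sub_comm (s : ℝ)]; exact hone t s hst) (by
    intro h1; exact h0 (by rw [← hFh, h1]))
  rw [hGF]; exact funext fun t => by simp [hid t]

/-! ### Discrete traces of an arc -/

theorem plane_dist_sq (x y : Plane) : dist x y ^ 2 = (x 0 - y 0) ^ 2 + (x 1 - y 1) ^ 2 := by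
  rw [EuclideanSpace.dist_eq, Real.sq_sqrt (by positivity)]
  simp [Real.dist_eq, sq_abs]

theorem plane_dist_le (x y : Plane) : dist x y ≤ |x 0 - y 0| + |x 1 - y 1| := by
  refine abs_le_of_sq_le_sq' ?_ (by positivity) |>.2
  rw [plane_dist_sq, ← sq_abs (x 0 - y 0), ← sq_abs (x 1 - y 1)]
  nlinarith [mul_nonneg (abs_nonneg (x 0 - y 0)) (abs_nonneg (x 1 - y 1))]

theorem abs_coord_sub_le (x y : Plane) (k : Fin 2) : |x k - y k| ≤ dist x y := by
  refine abs_le_of_sq_le_sq ?_ dist_nonneg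
  rw [plane_dist_sq]
  fin_cases k <;> simp <;> positivity

/-- The point `g / 2 ^ m` of the plane. -/
def latticePt (m : ℕ) (g : ℤ × ℤ) : Plane := !₂[(g.1 : ℝ) / 2 ^ m, (g.2 : ℝ) / 2 ^ m]

@[simp] theorem latticePt_zero (m : ℕ) (g : ℤ × ℤ) : latticePt m g 0 = (g.1 : ℝ) / 2 ^ m := rfl
@[simp] theorem latticePt_one (m : ℕ) (g : ℤ × ℤ) : latticePt m g 1 = (g.2 : ℝ) / 2 ^ m := rfl

/-- The point `i / 2 ^ m` of the unit interval. -/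
def grid (m i : ℕ) : I := projIcc 0 1 zero_le_one ((i : ℝ) / 2 ^ m)

theorem coe_grid {m i : ℕ} (hi : i ≤ 2 ^ m) : (grid m i : ℝ) = (i : ℝ) / 2 ^ m := by
  have h : (i : ℝ) / 2 ^ m ∈ Icc (0 : ℝ) 1 :=
    ⟨by positivity, (div_le_one (by positivity)).2 (by exact_mod_cast hi)⟩
  rw [grid, projIcc_of_mem _ h]

/-- `p 0, …, p (2 ^ m)` is a list of points of the lattice of mesh `2 ^ (-m)` that lie in `S`, come
close to all points of `S`, start near the point `a / 2 ^ k`, and are almost Lipschitz with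
constant `ℓ / 2 ^ m`. -/
structure IsTrace (S : Set (ℤ × ℤ)) (ℓ c k : ℕ) (a : ℤ × ℤ) (m : ℕ) (p : ℕ → ℤ × ℤ) : Prop where
  mem : ∀ i < 2 ^ m + 1, p i ∈ S
  lip : ∀ i < 2 ^ m + 1, ∀ j < 2 ^ m + 1,
    4 ^ m * (((p i).1 - (p j).1) ^ 2 + ((p i).2 - (p j).2) ^ 2) ≤
      ((ℓ : ℤ) * |(i : ℤ) - j| + 3 * 2 ^ m) ^ 2
  dense : ∀ g ∈ S, ∃ i < 2 ^ m + 1, |g.1 - (p i).1| ≤ c ∧ |g.2 - (p i).2| ≤ c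
  start : |2 ^ k * (p 0).1 - 2 ^ m * a.1| ≤ 2 ^ m + 2 ^ k ∧
    |2 ^ k * (p 0).2 - 2 ^ m * a.2| ≤ 2 ^ m + 2 ^ k

/-- The point of the lattice of mesh `2 ^ (-m)` below `z`. -/
def latticeFloor (m : ℕ) (z : Plane) : ℤ × ℤ := (⌊2 ^ m * z 0⌋, ⌊2 ^ m * z 1⌋)

/-- The data from which the arc `C` with arc length parametrization `F` is recovered. -/
structure TraceData (F : I → Plane) (C : Set Plane) (L : ℝ) (S : ℕ → Set (ℤ × ℤ)) (ℓ : ℕ → ℕ)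
    (c k : ℕ) (a : ℤ × ℤ) : Prop where
  arc : IsArcParam F C L
  floor_mem : ∀ m, ∀ z ∈ C, latticeFloor m z ∈ S m
  near : ∀ m, ∀ g ∈ S m, ∃ z ∈ C, |(g.1 : ℝ) - 2 ^ m * z 0| ≤ 2 ∧ |(g.2 : ℝ) - 2 ^ m * z 1| ≤ 2
  le_len : ∀ m, L * 2 ^ m ≤ ℓ m
  len_le : ∀ m, (ℓ m : ℝ) ≤ L * 2 ^ m + 5
  le_c : L + 3 ≤ c
  start : |2 ^ k * F 0 0 - a.1| ≤ 1 ∧ |2 ^ k * F 0 1 - a.2| ≤ 1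
  not_end : ¬ (|2 ^ k * F 1 0 - a.1| ≤ 1 ∧ |2 ^ k * F 1 1 - a.2| ≤ 1)

theorem abs_floor_sub_floor_le (x y : ℝ) : |((⌊x⌋ : ℝ)) - ⌊y⌋| ≤ |x - y| + 1 := by
  have h1 := Int.floor_le x
  have h2 := Int.lt_floor_add_one x
  have h3 := Int.floor_le y
  have h4 := Int.lt_floor_add_one y
  rw [abs_le]
  constructor
  · linarith [neg_abs_le (x - y)]
  · linarith [le_abs_self (x - y)]

theorem dist_latticePt_floor_le (m : ℕ) (z : Plane) : dist (latticePt m (latticeFloor m z)) z ≤ 2 / 2 ^ m := by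
  have hm : (0 : ℝ) < 2 ^ m := by positivity
  have key : ∀ x : ℝ, |(⌊2 ^ m * x⌋ : ℝ) / 2 ^ m - x| ≤ 1 / 2 ^ m := by
    intro x
    have h1 := Int.floor_le (2 ^ m * x)
    have h2 := Int.lt_floor_add_one (2 ^ m * x)
    have : (⌊2 ^ m * x⌋ : ℝ) / 2 ^ m - x = (⌊2 ^ m * x⌋ - 2 ^ m * x) / 2 ^ m := by field_simp
    rw [this, abs_div, abs_of_pos hm, div_le_div_iff_of_pos_right hm, abs_le]
    constructor <;> linarith
  refine (plane_dist_le _ _).trans ?_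
  have h0 := key (z 0)
  have h1 := key (z 1)
  simp only [latticePt_zero, latticePt_one, latticeFloor]
  calc _ ≤ 1 / 2 ^ m + 1 / 2 ^ m := add_le_add h0 h1
    _ = 2 / (2 : ℝ) ^ m := by ring

theorem tendsto_const_div_two_pow {l : Filter ℕ} (hl : l ≤ atTop) (x : ℝ) :
    Tendsto (fun m : ℕ => x / 2 ^ m) l (𝓝 0) := by
  have := (tendsto_pow_atTop_nhds_zero_of_lt_one (r := (1 / 2 : ℝ)) (by norm_num)
    (by norm_num)).const_mul x
  simp only [mul_zero] at this
  refine (this.mono_left hl).congr fun m => ?_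
  rw [one_div, inv_pow, div_eq_mul_inv]

/-! ### Compactness: traces converge to the arc length parametrization -/

namespace TraceData

variable {F : I → Plane} {C : Set Plane} {L : ℝ} {S : ℕ → Set (ℤ × ℤ)} {ℓ : ℕ → ℕ} {c k : ℕ}
  {a : ℤ × ℤ}

/-- This explains the constants in `IsTrace`. Rounding costs up to `1` per coordinate, and `3`
absorbs it in the squared distance. In `dense`, `c ≥ L + 3` collects `2` from `near`, `L` from one
grid step and `1` from rounding. In `start`, `2 ^ m` is the tolerance for `F 0` and `2 ^ k` the
rounding. -/
theorem isTrace_floor (h : TraceData F C L S ℓ c k a) (m : ℕ) :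
    IsTrace (S m) (ℓ m) c k a m (fun i => latticeFloor m (F (grid m i))) := by
  have hm : (0 : ℝ) < 2 ^ m := by positivity
  have hm0 : (2 : ℝ) ^ m ≠ 0 := hm.ne'
  have hL := h.arc.pos
  have hC : ∀ t, F t ∈ C := fun t => h.arc.inj.2.2 ▸ ⟨t, rfl⟩
  refine ⟨fun i _ => h.floor_mem m _ (hC _), fun i hi j hj => ?_, fun g hg => ?_, ?_⟩
  · have hd := h.arc.dist_le (grid m i) (grid m j)
    rw [coe_grid (by omega), coe_grid (by omega), ← sub_div, abs_div, abs_of_pos hm] at hd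
    set x := F (grid m i)
    set y := F (grid m j)
    set D : ℝ := |(i : ℝ) - j| with hD
    have hD0 : 0 ≤ D := abs_nonneg _
    have hsq := plane_dist_sq x y
    have h0 := abs_floor_sub_floor_le (2 ^ m * x 0) (2 ^ m * y 0)
    have h1 := abs_floor_sub_floor_le (2 ^ m * x 1) (2 ^ m * y 1)
    have e0 : ∀ k, |2 ^ m * x k - 2 ^ m * y k| = 2 ^ m * |x k - y k| := fun k => by
      rw [← mul_sub, abs_mul, abs_of_pos hm]
    rw [e0] at h0 h1
    have h2 : 2 ^ m * dist x y ≤ L * D := by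
      calc 2 ^ m * dist x y ≤ 2 ^ m * (L * (D / 2 ^ m)) := by gcongr
        _ = L * D := by field_simp
    have hx0 := abs_nonneg (x 0 - y 0)
    have hx1 := abs_nonneg (x 1 - y 1)
    have hle0 := abs_coord_sub_le x y 0
    have hle1 := abs_coord_sub_le x y 1
    have h3 : ((⌊2 ^ m * x 0⌋ : ℝ) - ⌊2 ^ m * y 0⌋) ^ 2 + ((⌊2 ^ m * x 1⌋ : ℝ) - ⌊2 ^ m * y 1⌋) ^ 2 ≤
        (L * D + 3) ^ 2 := by
      have g0 : ((⌊2 ^ m * x 0⌋ : ℝ) - ⌊2 ^ m * y 0⌋) ^ 2 ≤ (2 ^ m * |x 0 - y 0| + 1) ^ 2 :=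
        sq_le_sq.2 (by rwa [abs_of_nonneg (a := 2 ^ m * |x 0 - y 0| + 1) (by positivity)])
      have g1 : ((⌊2 ^ m * x 1⌋ : ℝ) - ⌊2 ^ m * y 1⌋) ^ 2 ≤ (2 ^ m * |x 1 - y 1| + 1) ^ 2 :=
        sq_le_sq.2 (by rwa [abs_of_nonneg (a := 2 ^ m * |x 1 - y 1| + 1) (by positivity)])
      have q : (2 ^ m * |x 0 - y 0|) ^ 2 + (2 ^ m * |x 1 - y 1|) ^ 2 = (2 ^ m * dist x y) ^ 2 := by
        rw [mul_pow _ (dist x y), hsq, mul_pow, mul_pow, sq_abs, sq_abs]; ring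
      have q0 : 2 ^ m * |x 0 - y 0| ≤ L * D := (mul_le_mul_of_nonneg_left hle0 hm.le).trans h2
      have q1 : 2 ^ m * |x 1 - y 1| ≤ L * D := (mul_le_mul_of_nonneg_left hle1 hm.le).trans h2
      have q2 : (2 ^ m * dist x y) ^ 2 ≤ (L * D) ^ 2 := by gcongr
      nlinarith
    have h4 : (2 ^ m) * (L * D + 3) ≤ (ℓ m : ℝ) * D + 3 * 2 ^ m := by
      have := mul_le_mul_of_nonneg_right (h.le_len m) hD0
      linarith
    have h5 : ((2 ^ m) * (L * D + 3)) ^ 2 ≤ ((ℓ m : ℝ) * D + 3 * 2 ^ m) ^ 2 := by gcongr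
    have h6 : (4 : ℝ) ^ m = (2 ^ m) ^ 2 := by rw [← pow_mul, mul_comm, pow_mul]; norm_num
    have : (4 : ℝ) ^ m * (((⌊2 ^ m * x 0⌋ : ℝ) - ⌊2 ^ m * y 0⌋) ^ 2 +
        ((⌊2 ^ m * x 1⌋ : ℝ) - ⌊2 ^ m * y 1⌋) ^ 2) ≤ ((ℓ m : ℝ) * D + 3 * 2 ^ m) ^ 2 := by
      refine le_trans ?_ h5
      rw [mul_pow, h6]
      gcongr
    rw [hD] at this
    simp only [latticeFloor]
    rw [← Int.cast_le (R := ℝ)]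
    push_cast
    exact this
  · obtain ⟨z, hz, hz0, hz1⟩ := h.near m g hg
    obtain ⟨t, rfl⟩ : z ∈ range F := h.arc.inj.2.2 ▸ hz
    have ht0 := t.2.1
    have ht1 := t.2.2
    have hfl := Nat.floor_le (mul_nonneg ht0 hm.le)
    have hfl' := Nat.lt_floor_add_one ((t : ℝ) * 2 ^ m)
    have hi : ⌊(t : ℝ) * 2 ^ m⌋₊ ≤ 2 ^ m := by
      apply Nat.floor_le_of_le
      push_cast
      nlinarith
    refine ⟨⌊(t : ℝ) * 2 ^ m⌋₊, by omega, ?_⟩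
    set i := ⌊(t : ℝ) * 2 ^ m⌋₊
    have hd := h.arc.dist_le t (grid m i)
    rw [coe_grid hi] at hd
    have hti : |(t : ℝ) - i / 2 ^ m| ≤ 1 / 2 ^ m := by
      have : (t : ℝ) - i / 2 ^ m = (t * 2 ^ m - i) / 2 ^ m := by field_simp
      rw [this, abs_div, abs_of_pos hm, div_le_div_iff_of_pos_right hm, abs_le]
      constructor <;> linarith
    have hd2 : 2 ^ m * dist (F t) (F (grid m i)) ≤ L := by
      calc _ ≤ 2 ^ m * (L * (1 / 2 ^ m)) := by gcongr; exact hd.trans (by gcongr)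
        _ = L := by field_simp
    have key : ∀ (q : Fin 2) (x : ℤ), |(x : ℝ) - 2 ^ m * F t q| ≤ 2 →
        |x - ⌊2 ^ m * F (grid m i) q⌋| ≤ c := by
      intro q x hx
      have e1 := abs_coord_sub_le (F t) (F (grid m i)) q
      have e2 : |2 ^ m * F t q - 2 ^ m * F (grid m i) q| ≤ L := by
        rw [← mul_sub, abs_mul, abs_of_pos hm]
        exact (mul_le_mul_of_nonneg_left e1 hm.le).trans hd2
      have e3 := Int.floor_le (2 ^ m * F (grid m i) q)
      have e4 := Int.lt_floor_add_one (2 ^ m * F (grid m i) q)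
      have e5 : |(x : ℝ) - ⌊2 ^ m * F (grid m i) q⌋| ≤ c := by
        rw [abs_le] at hx e2 ⊢
        have := h.le_c
        constructor <;> linarith [hx.1, hx.2, e2.1, e2.2]
      exact_mod_cast e5
    exact ⟨key 0 _ hz0, key 1 _ hz1⟩
  · have hg : grid m 0 = 0 := Subtype.ext (by rw [coe_grid (Nat.zero_le _)]; simp)
    have key : ∀ (x : ℝ) (b : ℤ), |2 ^ k * x - b| ≤ 1 →
        |2 ^ k * ⌊2 ^ m * x⌋ - 2 ^ m * b| ≤ 2 ^ m + 2 ^ k := by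
      intro x b hx
      have hk : (0 : ℝ) < 2 ^ k := by positivity
      have e3 := Int.floor_le (2 ^ m * x)
      have e4 := Int.lt_floor_add_one (2 ^ m * x)
      have : |(2 : ℝ) ^ k * ⌊2 ^ m * x⌋ - 2 ^ m * b| ≤ 2 ^ m + 2 ^ k := by
        rw [abs_le] at hx ⊢
        have e5 := mul_le_mul_of_nonneg_left e3 hk.le
        have e6 := mul_le_mul_of_nonneg_left e4.le hk.le
        have e7 := mul_le_mul_of_nonneg_left hx.1 hm.le
        have e8 := mul_le_mul_of_nonneg_left hx.2 hm.le
        constructor <;> nlinarith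
      exact_mod_cast this
    simp only [hg]
    exact ⟨key _ _ h.start.1, key _ _ h.start.2⟩

/-- The `8` is `3` from the trace condition plus `5` from the excess of `ℓ m` over `L * 2 ^ m`,
using `|i - j| ≤ 2 ^ m`. -/
theorem dist_le_of_isTrace (h : TraceData F C L S ℓ c k a) {m : ℕ} {p : ℕ → ℤ × ℤ}
    (hp : IsTrace (S m) (ℓ m) c k a m p) {i j : ℕ} (hi : i ≤ 2 ^ m) (hj : j ≤ 2 ^ m) :
    dist (latticePt m (p i)) (latticePt m (p j)) ≤
      L * |(i : ℝ) / 2 ^ m - j / 2 ^ m| + 8 / 2 ^ m := by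
  have hm : (0 : ℝ) < 2 ^ m := by positivity
  have h1 := hp.lip i (by omega) j (by omega)
  set D : ℝ := |(i : ℝ) - j| with hD
  have hD0 : 0 ≤ D := abs_nonneg _
  have hDm : D ≤ 2 ^ m := by
    have hi' : (i : ℝ) ≤ 2 ^ m := by exact_mod_cast hi
    have hj' : (j : ℝ) ≤ 2 ^ m := by exact_mod_cast hj
    rw [hD, abs_le]
    constructor <;> linarith [Nat.cast_nonneg (α := ℝ) i, Nat.cast_nonneg (α := ℝ) j]
  have h2 : (4 : ℝ) ^ m * ((((p i).1 : ℝ) - (p j).1) ^ 2 + (((p i).2 : ℝ) - (p j).2) ^ 2) ≤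
      ((ℓ m : ℝ) * D + 3 * 2 ^ m) ^ 2 := by
    rw [hD]; exact_mod_cast h1
  have h6 : (4 : ℝ) ^ m = (2 ^ m) ^ 2 := by rw [← pow_mul, mul_comm, pow_mul]; norm_num
  have h3 : (2 ^ m * (2 ^ m * dist (latticePt m (p i)) (latticePt m (p j)))) ^ 2 ≤
      ((ℓ m : ℝ) * D + 3 * 2 ^ m) ^ 2 := by
    refine le_trans (le_of_eq ?_) h2
    rw [mul_pow, mul_pow, plane_dist_sq, h6]
    simp only [latticePt_zero, latticePt_one]
    field_simp
  have h4 : 2 ^ m * (2 ^ m * dist (latticePt m (p i)) (latticePt m (p j))) ≤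
      (ℓ m : ℝ) * D + 3 * 2 ^ m :=
    (abs_le_of_sq_le_sq' h3 (by positivity)).2
  have h5 : (ℓ m : ℝ) * D + 3 * 2 ^ m ≤ 2 ^ m * (L * D + 8) := by
    have := mul_le_mul_of_nonneg_right (h.len_le m) hD0
    linarith
  have h7 : 2 ^ m * dist (latticePt m (p i)) (latticePt m (p j)) ≤ L * D + 8 :=
    le_of_mul_le_mul_left (h4.trans h5) hm
  rw [← sub_div, abs_div, abs_of_pos hm, ← hD]
  rw [← mul_div_assoc, ← add_div, le_div_iff₀ hm]
  linarith

theorem exists_dist_le_of_mem (h : TraceData F C L S ℓ c k a) {m : ℕ} {g : ℤ × ℤ} (hg : g ∈ S m) :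
    ∃ z ∈ C, dist (latticePt m g) z ≤ 4 / 2 ^ m := by
  have hm : (0 : ℝ) < 2 ^ m := by positivity
  obtain ⟨z, hz, h0, h1⟩ := h.near m g hg
  refine ⟨z, hz, (plane_dist_le _ _).trans ?_⟩
  have key : ∀ x y : ℝ, |x - 2 ^ m * y| ≤ 2 → |x / 2 ^ m - y| ≤ 2 / 2 ^ m := by
    intro x y hxy
    have : x / 2 ^ m - y = (x - 2 ^ m * y) / 2 ^ m := by field_simp
    rw [this, abs_div, abs_of_pos hm]
    gcongr
  calc _ ≤ 2 / (2 : ℝ) ^ m + 2 / 2 ^ m := add_le_add (key _ _ h0) (key _ _ h1)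
    _ = 4 / 2 ^ m := by ring

/-- Limits of traces along an ultrafilter are the arc length parametrization. -/
theorem tendsto_of_isTrace (h : TraceData F C L S ℓ c k a) {𝒰 : Ultrafilter ℕ}
    (h𝒰 : (𝒰 : Filter ℕ) ≤ atTop) {p : ℕ → ℕ → ℤ × ℤ}
    (hp : ∀ᶠ m in 𝒰, IsTrace (S m) (ℓ m) c k a m (p m)) {i : ℕ → ℕ} {t : I}
    (hi : ∀ᶠ m in 𝒰, i m ≤ 2 ^ m) (ht : Tendsto (fun m => grid m (i m)) 𝒰 (𝓝 t)) :
    Tendsto (fun m => latticePt m (p m (i m))) 𝒰 (𝓝 (F t)) := by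
  have hL := h.arc.pos
  have hCcomp : IsCompact C := by
    rw [← h.arc.inj.2.2]; exact isCompact_range h.arc.inj.1
  obtain ⟨R, hR⟩ := hCcomp.isBounded.subset_closedBall (0 : Plane)
  set fl : ℕ → I → ℕ := fun m t => ⌊(t : ℝ) * 2 ^ m⌋₊ with hfl
  have hflle : ∀ m t, fl m t ≤ 2 ^ m := fun m t => by
    apply Nat.floor_le_of_le
    push_cast
    exact mul_le_of_le_one_left (by positivity) t.2.2
  have hflabs : ∀ m (t : I), |(t : ℝ) - fl m t / 2 ^ m| ≤ 1 / 2 ^ m := fun m t => by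
    have hm : (0 : ℝ) < 2 ^ m := by positivity
    have h1 := Nat.floor_le (mul_nonneg t.2.1 hm.le)
    have h2 := Nat.lt_floor_add_one ((t : ℝ) * 2 ^ m)
    have : (t : ℝ) - fl m t / 2 ^ m = (t * 2 ^ m - fl m t) / 2 ^ m := by field_simp
    rw [this, abs_div, abs_of_pos hm, div_le_div_iff_of_pos_right hm, abs_le]
    simp only [hfl]
    constructor <;> linarith
  -- Traces stay within `4` of the bounded set `C`, so the ultrafilter has limits at every
  -- parameter, with no diagonal subsequence.
  have hlim : ∀ t : I, ∃ x : Plane, Tendsto (fun m => latticePt m (p m (fl m t))) 𝒰 (𝓝 x) := by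
    intro t
    have hK : IsCompact (Metric.closedBall (0 : Plane) (R + 4)) := isCompact_closedBall _ _
    obtain ⟨x, -, hx⟩ := hK.ultrafilter_le_nhds
      (𝒰.map fun m => latticePt m (p m (fl m t))) (by
        rw [Ultrafilter.coe_map, le_principal_iff, mem_map]
        filter_upwards [hp] with m hm
        obtain ⟨z, hz, hzd⟩ := h.exists_dist_le_of_mem (hm.mem (fl m t) (by have := hflle m t; omega))
        have h1 := hR hz
        have h2 : (4 : ℝ) / 2 ^ m ≤ 4 := div_le_self (by norm_num) (one_le_pow₀ (by norm_num))
        rw [mem_preimage, Metric.mem_closedBall] at *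
        linarith [dist_triangle (latticePt m (p m (fl m t))) z 0])
    exact ⟨x, hx⟩
  choose G hG using hlim
  -- By the almost-Lipschitz bound, the limit depends only on the limit parameter, not on the chosen
  -- grid indices.
  have hGi : ∀ (i : ℕ → ℕ) (t : I), (∀ᶠ m in 𝒰, i m ≤ 2 ^ m) →
      Tendsto (fun m => grid m (i m)) 𝒰 (𝓝 t) →
      Tendsto (fun m => latticePt m (p m (i m))) 𝒰 (𝓝 (G t)) := by
    intro i t hi ht
    refine (hG t).congr_dist ?_
    have ht' : Tendsto (fun m => dist t (grid m (i m))) 𝒰 (𝓝 0) := by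
      have := (tendsto_const_nhds (x := t)).dist ht
      rwa [dist_self] at this
    have hb : Tendsto (fun m : ℕ => L * (1 / 2 ^ m + dist t (grid m (i m))) + 8 / 2 ^ m) 𝒰 (𝓝 0) := by
      have := (((tendsto_const_div_two_pow h𝒰 1).add ht').const_mul L).add
        (tendsto_const_div_two_pow h𝒰 8)
      simpa using this
    refine squeeze_zero' (Eventually.of_forall fun _ => dist_nonneg) ?_ hb
    filter_upwards [hp, hi] with m hm him
    refine (h.dist_le_of_isTrace hm (hflle m t) him).trans ?_
    have h1 := hflabs m t
    have h2 : |(t : ℝ) - i m / 2 ^ m| = dist t (grid m (i m)) := by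
      rw [Subtype.dist_eq, coe_grid him, Real.dist_eq]
    gcongr
    rw [← h2]
    calc |(fl m t : ℝ) / 2 ^ m - i m / 2 ^ m|
        ≤ |(fl m t : ℝ) / 2 ^ m - t| + |(t : ℝ) - i m / 2 ^ m| := abs_sub_le _ _ _
      _ ≤ _ := by rw [abs_sub_comm] at h1; gcongr
  have hGlip : ∀ s t, dist (G s) (G t) ≤ L * |(s : ℝ) - t| := by
    intro s t
    have hb : Tendsto (fun m : ℕ => L * (|(s : ℝ) - t| + 2 / 2 ^ m) + 8 / 2 ^ m) 𝒰
        (𝓝 (L * |(s : ℝ) - t|)) := by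
      have := (((tendsto_const_nhds (x := |(s : ℝ) - t|)).add
        (tendsto_const_div_two_pow h𝒰 2)).const_mul L).add (tendsto_const_div_two_pow h𝒰 8)
      simpa using this
    refine le_of_tendsto_of_tendsto ((hG s).dist (hG t)) hb ?_
    filter_upwards [hp] with m hm
    refine (h.dist_le_of_isTrace hm (hflle m s) (hflle m t)).trans ?_
    gcongr
    have h1 := abs_le.1 (hflabs m s)
    have h2 := abs_le.1 (hflabs m t)
    have h3 := abs_le.1 (le_refl |(s : ℝ) - t|)
    have h4 : (2 : ℝ) / 2 ^ m = 1 / 2 ^ m + 1 / 2 ^ m := by ring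
    rw [h4, abs_le]
    constructor <;> linarith
  have hGC : range G ⊆ C := by
    rintro _ ⟨t, rfl⟩
    have hz : ∀ m, ∃ z : Plane, IsTrace (S m) (ℓ m) c k a m (p m) →
        z ∈ C ∧ dist (latticePt m (p m (fl m t))) z ≤ 4 / 2 ^ m := by
      intro m
      by_cases hm : IsTrace (S m) (ℓ m) c k a m (p m)
      · obtain ⟨z, hz, hzd⟩ := h.exists_dist_le_of_mem
          (hm.mem (fl m t) (by have := hflle m t; omega))
        exact ⟨z, fun _ => ⟨hz, hzd⟩⟩
      · exact ⟨0, fun h => absurd h hm⟩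
    choose z hz using hz
    have hzlim : Tendsto z 𝒰 (𝓝 (G t)) := by
      refine (hG t).congr_dist (squeeze_zero' (Eventually.of_forall fun _ => dist_nonneg) ?_
        (tendsto_const_div_two_pow h𝒰 4))
      filter_upwards [hp] with m hm using (hz m hm).2
    exact hCcomp.isClosed.mem_of_tendsto hzlim (by filter_upwards [hp] with m hm using (hz m hm).1)
  have hCG : C ⊆ range G := by
    intro z hz
    have hi : ∀ m, ∃ i, i ≤ 2 ^ m ∧ (IsTrace (S m) (ℓ m) c k a m (p m) →
        dist (latticePt m (p m i)) z ≤ (2 * c + 2) / 2 ^ m) := by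
      intro m
      have hm2 : (0 : ℝ) < 2 ^ m := by positivity
      by_cases hm : IsTrace (S m) (ℓ m) c k a m (p m)
      · obtain ⟨i, hi, hi0, hi1⟩ := hm.dense _ (h.floor_mem m z hz)
        refine ⟨i, by omega, fun _ => ?_⟩
        have key : ∀ x y : ℤ, |x - y| ≤ c → |(y : ℝ) / 2 ^ m - x / 2 ^ m| ≤ c / 2 ^ m := by
          intro x y hxy
          rw [← sub_div, abs_div, abs_of_pos hm2, abs_sub_comm]
          gcongr
          exact_mod_cast hxy
        have h1 : dist (latticePt m (p m i)) (latticePt m (latticeFloor m z)) ≤ 2 * c / 2 ^ m := by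
          refine (plane_dist_le _ _).trans ?_
          simp only [latticePt_zero, latticePt_one]
          calc _ ≤ (c : ℝ) / 2 ^ m + c / 2 ^ m := add_le_add (key _ _ hi0) (key _ _ hi1)
            _ = _ := by ring
        calc _ ≤ _ := dist_triangle _ (latticePt m (latticeFloor m z)) _
          _ ≤ 2 * c / 2 ^ m + 2 / 2 ^ m := add_le_add h1 (dist_latticePt_floor_le m z)
          _ = _ := by ring
      · exact ⟨0, Nat.zero_le _, fun h => absurd h hm⟩
    choose i hi hiz using hi
    obtain ⟨t, -, ht⟩ := (isCompact_univ (X := I)).ultrafilter_le_nhds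
      (𝒰.map fun m => grid m (i m)) (by simp)
    have h1 := hGi i t (Eventually.of_forall hi) ht
    have h2 : Tendsto (fun m => latticePt m (p m (i m))) 𝒰 (𝓝 z) := by
      rw [tendsto_iff_dist_tendsto_zero]
      refine squeeze_zero' (Eventually.of_forall fun _ => dist_nonneg) ?_
        (tendsto_const_div_two_pow h𝒰 (2 * c + 2))
      filter_upwards [hp] with m hm using hiz m hm
    exact ⟨t, tendsto_nhds_unique h1 h2⟩
  -- The start condition is closed: its error `2 ^ k / 2 ^ m` vanishes, and `G 0` satisfies in the
  -- limit what `not_end` denies to `F 1`.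
  have hstart : G 0 ≠ F 1 := by
    intro h01
    refine h.not_end ?_
    have hk : (0 : ℝ) < 2 ^ k := by positivity
    have key : ∀ (q : Fin 2) (b : ℤ), (∀ᶠ m in 𝒰,
        |2 ^ k * latticePt m (p m 0) q - b| ≤ 1 + 2 ^ k / 2 ^ m) → |2 ^ k * F 1 q - b| ≤ 1 := by
      intro q b hq
      have h0 := hG 0
      have hfl0 : ∀ m, fl m 0 = 0 := fun m => by simp [hfl]
      simp only [hfl0] at h0
      rw [h01] at h0
      have h1 : Tendsto (fun m => latticePt m (p m 0) q) 𝒰 (𝓝 (F 1 q)) :=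
        ((EuclideanSpace.proj (𝕜 := ℝ) q).continuous.tendsto _).comp h0
      have h2 := ((h1.const_mul (2 ^ k)).sub_const (b : ℝ)).abs
      have h3 := (tendsto_const_div_two_pow h𝒰 (2 ^ k)).const_add 1
      rw [add_zero] at h3
      exact le_of_tendsto_of_tendsto h2 h3 hq
    have key2 : ∀ (m : ℕ) (x b : ℤ), |2 ^ k * x - 2 ^ m * b| ≤ 2 ^ m + 2 ^ k →
        |(2 : ℝ) ^ k * (x / 2 ^ m) - b| ≤ 1 + 2 ^ k / 2 ^ m := by
      intro m x b hx
      have hm2 : (0 : ℝ) < 2 ^ m := by positivity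
      have hx' : |(2 : ℝ) ^ k * x - 2 ^ m * b| ≤ 2 ^ m + 2 ^ k := by exact_mod_cast hx
      have e1 : (2 : ℝ) ^ k * (x / 2 ^ m) - b = (2 ^ k * x - 2 ^ m * b) / 2 ^ m := by field_simp
      have e2 : (1 : ℝ) + 2 ^ k / 2 ^ m = (2 ^ m + 2 ^ k) / 2 ^ m := by field_simp
      rw [e1, e2, abs_div, abs_of_pos hm2]
      gcongr
    exact ⟨key 0 _ (by filter_upwards [hp] with m hm using key2 m _ _ hm.start.1),
      key 1 _ (by filter_upwards [hp] with m hm using key2 m _ _ hm.start.2)⟩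
  have hGF : G = F := h.arc.unique hGlip (hGC.antisymm hCG) hstart
  rw [← hGF]
  exact hGi i t hi ht

/-- Otherwise bad traces exist for arbitrarily large `m`; an ultrafilter on these `m` has them
converge to `F` at a limit parameter, where they should stay `ε` away. The argument gives no rate
and only guarantees that the search ends. -/
theorem eventually_dist_le (h : TraceData F C L S ℓ c k a) {ε : ℝ} (hε : 0 < ε) :
    ∀ᶠ m in atTop, ∀ p, IsTrace (S m) (ℓ m) c k a m p → ∀ i ≤ 2 ^ m,
      dist (latticePt m (p i)) (F (grid m i)) ≤ ε := by
  by_contra hcon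
  rw [not_eventually] at hcon
  set B : Set ℕ := {m | ¬ ∀ p, IsTrace (S m) (ℓ m) c k a m p → ∀ i ≤ 2 ^ m,
      dist (latticePt m (p i)) (F (grid m i)) ≤ ε} with hB
  have hne : NeBot (atTop ⊓ 𝓟 B) := frequently_mem_iff_neBot.1 hcon
  set 𝒰 := Ultrafilter.of (atTop ⊓ 𝓟 B)
  have hle := Ultrafilter.of_le (atTop ⊓ 𝓟 B)
  have h𝒰 : (𝒰 : Filter ℕ) ≤ atTop := hle.trans inf_le_left
  have hBU : ∀ᶠ m in 𝒰, m ∈ B := le_principal_iff.1 (hle.trans inf_le_right)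
  have hex : ∀ m, ∃ (p : ℕ → ℤ × ℤ) (i : ℕ), m ∈ B → IsTrace (S m) (ℓ m) c k a m p ∧
      i ≤ 2 ^ m ∧ ε < dist (latticePt m (p i)) (F (grid m i)) := by
    intro m
    by_cases hm : m ∈ B
    · simp only [hB, mem_ofPred_eq] at hm
      push Not at hm
      obtain ⟨p, hp, i, hi, hd⟩ := hm
      exact ⟨p, i, fun _ => ⟨hp, hi, hd⟩⟩
    · exact ⟨fun _ => 0, 0, fun h => absurd h hm⟩
  choose p i hpi using hex
  obtain ⟨t, -, ht⟩ := (isCompact_univ (X := I)).ultrafilter_le_nhds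
    (𝒰.map fun m => grid m (i m)) (by simp)
  have ht' : Tendsto (fun m => grid m (i m)) 𝒰 (𝓝 t) := ht
  have h1 := h.tendsto_of_isTrace h𝒰 (p := p) (hBU.mono fun m hm => (hpi m hm).1)
    (hBU.mono fun m hm => (hpi m hm).2.1) ht'
  have h2 : Tendsto (fun m => F (grid m (i m))) 𝒰 (𝓝 (F t)) :=
    (h.arc.inj.1.tendsto t).comp ht'
  have h3 := h1.dist h2
  rw [dist_self] at h3
  obtain ⟨m, hm, hmB⟩ := ((h3.eventually (gt_mem_nhds hε)).and hBU).exists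
  exact (hpi m hmB).2.2.not_gt hm

end TraceData

/-! ### Primitive recursive functions on the integers and bounded quantifiers -/

attribute [fun_prop] Primrec PrimrecPred
attribute [fun_prop] Primrec.const Primrec.comp Primrec.fst Primrec.snd Primrec.pair
attribute [fun_prop] PrimrecPred.and PrimrecPred.or PrimrecPred.not

section Primrec

variable {α β γ : Type*} [Primcodable α] [Primcodable β] [Primcodable γ]

@[fun_prop] theorem primrec_id' : Primrec (fun a : α => a) := Primrec.id

section Nat

variable {f g : α → ℕ}

@[fun_prop] theorem primrec_nat_add (hf : Primrec f) (hg : Primrec g) :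
    Primrec fun a => f a + g a := Primrec.nat_add.comp hf hg

@[fun_prop] theorem primrec_nat_sub (hf : Primrec f) (hg : Primrec g) :
    Primrec fun a => f a - g a := Primrec.nat_sub.comp hf hg

@[fun_prop] theorem primrec_nat_mul (hf : Primrec f) (hg : Primrec g) :
    Primrec fun a => f a * g a := Primrec.nat_mul.comp hf hg

@[fun_prop] theorem primrec_nat_div (hf : Primrec f) (hg : Primrec g) :
    Primrec fun a => f a / g a := Primrec.nat_div.comp hf hg

@[fun_prop] theorem primrec_nat_mod (hf : Primrec f) (hg : Primrec g) :
    Primrec fun a => f a % g a := Primrec.nat_mod.comp hf hg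

@[fun_prop] theorem primrec_nat_min (hf : Primrec f) (hg : Primrec g) :
    Primrec fun a => min (f a) (g a) := Primrec.nat_min.comp hf hg

@[fun_prop] theorem primrec_nat_pow (hf : Primrec f) (hg : Primrec g) :
    Primrec fun a => f a ^ g a := by
  have : Primrec₂ ((· ^ ·) : ℕ → ℕ → ℕ) := Primrec₂.unpaired'.1 Nat.Primrec.pow
  exact this.comp hf hg

@[fun_prop] theorem primrecPred_nat_le (hf : Primrec f) (hg : Primrec g) :
    PrimrecPred fun a => f a ≤ g a := Primrec.nat_le.comp hf hg

@[fun_prop] theorem primrecPred_nat_lt (hf : Primrec f) (hg : Primrec g) :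
    PrimrecPred fun a => f a < g a := Primrec.nat_lt.comp hf hg

@[fun_prop] theorem primrecPred_eq {f g : α → β} (hf : Primrec f) (hg : Primrec g) :
    PrimrecPred fun a => f a = g a := Primrec.eq.comp hf hg

@[fun_prop] theorem primrec_unpair_fst (hf : Primrec f) : Primrec fun a => (f a).unpair.1 :=
  Primrec.fst.comp (Primrec.unpair.comp hf)

@[fun_prop] theorem primrec_unpair_snd (hf : Primrec f) : Primrec fun a => (f a).unpair.2 :=
  Primrec.snd.comp (Primrec.unpair.comp hf)

theorem primrec_ite {p : α → Prop} [DecidablePred p] {f g : α → β} (hp : PrimrecPred p)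
    (hf : Primrec f) (hg : Primrec g) : Primrec fun a => if p a then f a else g a :=
  Primrec.ite hp hf hg

end Nat

theorem primrec_int_ofNat : Primrec (fun n : ℕ => (n : ℤ)) :=
  Primrec.encode_iff.1 ((by fun_prop : Primrec fun n : ℕ => 2 * n).of_eq fun _ => rfl)

theorem primrec_int_negSucc : Primrec Int.negSucc :=
  Primrec.encode_iff.1 ((by fun_prop : Primrec fun n : ℕ => 2 * n + 1).of_eq fun _ => rfl)

theorem encode_int_ofNat (n : ℕ) : Encodable.encode (Int.ofNat n) = 2 * n := rfl

theorem encode_int_negSucc (n : ℕ) : Encodable.encode (Int.negSucc n) = 2 * n + 1 := rfl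

@[fun_prop] theorem primrec_int_toNat {f : α → ℤ} (hf : Primrec f) :
    Primrec fun a => (f a).toNat := by
  have h : Primrec Int.toNat := by
    have he : Primrec (Encodable.encode : ℤ → ℕ) := Primrec.encode
    refine (primrec_ite (p := fun z : ℤ => Encodable.encode z % 2 = 0)
      (f := fun z => Encodable.encode z / 2) (g := fun _ => 0) (by fun_prop) (by fun_prop)
      (by fun_prop)).of_eq fun z => ?_
    rcases z with n | n
    · rw [encode_int_ofNat]; simp
    · rw [encode_int_negSucc, if_neg (by omega)]; simp
  exact h.comp hf

@[fun_prop] theorem primrec_int_toNat_neg {f : α → ℤ} (hf : Primrec f) :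
    Primrec fun a => (-f a).toNat := by
  have h : Primrec fun z : ℤ => (-z).toNat := by
    have he : Primrec (Encodable.encode : ℤ → ℕ) := Primrec.encode
    refine (primrec_ite (p := fun z : ℤ => Encodable.encode z % 2 = 0)
      (f := fun _ => 0) (g := fun z => Encodable.encode z / 2 + 1) (by fun_prop) (by fun_prop)
      (by fun_prop)).of_eq fun z => ?_
    rcases z with n | n
    · rw [encode_int_ofNat]; simp
    · rw [encode_int_negSucc, if_neg (by omega)]
      have : -Int.negSucc n = ((n + 1 : ℕ) : ℤ) := by rw [Int.neg_negSucc]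
      rw [this, Int.toNat_natCast]; omega
  exact h.comp hf

@[fun_prop] theorem primrec_natCast {f : α → ℕ} (hf : Primrec f) : Primrec fun a => (f a : ℤ) :=
  primrec_int_ofNat.comp hf

/-- Integer arithmetic reduces to this case by splitting integers into positive and negative parts.
-/
theorem primrec_natCast_sub {f g : α → ℕ} (hf : Primrec f) (hg : Primrec g) :
    Primrec fun a => (f a : ℤ) - g a := by
  refine (primrec_ite (p := fun a => g a ≤ f a) (f := fun a => ((f a - g a : ℕ) : ℤ))
    (g := fun a => Int.negSucc (g a - f a - 1)) (by fun_prop) (by fun_prop)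
    (primrec_int_negSucc.comp (by fun_prop))).of_eq fun a => ?_
  split_ifs with h
  · omega
  · rw [Int.negSucc_eq]; omega

section Int

variable {f g : α → ℤ}

@[fun_prop] theorem primrec_int_add (hf : Primrec f) (hg : Primrec g) :
    Primrec fun a => f a + g a :=
  (primrec_natCast_sub (f := fun a => (f a).toNat + (g a).toNat)
    (g := fun a => (-f a).toNat + (-g a).toNat) (by fun_prop) (by fun_prop)).of_eq fun a => by omega

@[fun_prop] theorem primrec_int_sub (hf : Primrec f) (hg : Primrec g) :
    Primrec fun a => f a - g a :=
  (primrec_natCast_sub (f := fun a => (f a).toNat + (-g a).toNat)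
    (g := fun a => (-f a).toNat + (g a).toNat) (by fun_prop) (by fun_prop)).of_eq fun a => by omega

@[fun_prop] theorem primrec_int_abs (hf : Primrec f) : Primrec fun a => |f a| :=
  (by fun_prop : Primrec fun a => (((f a).toNat + (-f a).toNat : ℕ) : ℤ)).of_eq fun a => by
    rcases abs_cases (f a) with h | h <;> omega

@[fun_prop] theorem primrec_int_mul (hf : Primrec f) (hg : Primrec g) :
    Primrec fun a => f a * g a :=
  (primrec_natCast_sub
    (f := fun a => (f a).toNat * (g a).toNat + (-f a).toNat * (-g a).toNat)
    (g := fun a => (f a).toNat * (-g a).toNat + (-f a).toNat * (g a).toNat)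
    (by fun_prop) (by fun_prop)).of_eq fun a => by
      have h1 : f a = (f a).toNat - (-f a).toNat := by omega
      have h2 : g a = (g a).toNat - (-g a).toNat := by omega
      conv_rhs => rw [h1, h2]
      push_cast
      ring

@[fun_prop] theorem primrec_int_pow {n : α → ℕ} (hf : Primrec f) (hn : Primrec n) :
    Primrec fun a => f a ^ n a := by
  refine (Primrec.nat_rec' (f := n) (g := fun _ => (1 : ℤ)) (h := fun a (q : ℕ × ℤ) => q.2 * f a)
    hn (by fun_prop) (by unfold Primrec₂; fun_prop)).of_eq fun a => ?_
  induction n a with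
  | zero => simp
  | succ k ih => simp only [ih, pow_succ]

@[fun_prop] theorem primrecPred_int_le (hf : Primrec f) (hg : Primrec g) :
    PrimrecPred fun a => f a ≤ g a :=
  (by fun_prop : PrimrecPred fun a => (f a).toNat + (-g a).toNat ≤ (-f a).toNat + (g a).toNat).of_eq
    fun _ => by omega

@[fun_prop] theorem primrecPred_int_lt (hf : Primrec f) (hg : Primrec g) :
    PrimrecPred fun a => f a < g a :=
  (by fun_prop : PrimrecPred fun a => (f a).toNat + (-g a).toNat < (-f a).toNat + (g a).toNat).of_eq
    fun a => by omega

end Int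

theorem PrimrecPred.imp {p q : α → Prop} (hp : PrimrecPred p) (hq : PrimrecPred q) :
    PrimrecPred fun a => p a → q a :=
  (hp.not.or hq).of_eq fun _ => imp_iff_not_or.symm

theorem PrimrecPred.exists_mem {l : α → List β} {p : α → β → Prop} (hl : Primrec l)
    (hp : PrimrecPred fun q : α × β => p q.1 q.2) : PrimrecPred fun a => ∃ b ∈ l a, p a b := by
  have h : PrimrecRel fun (b : β) (a : α) => p a b :=
    hp.comp (f := fun q : β × α => (q.2, q.1)) (by fun_prop)
  exact h.exists_mem_list.comp hl Primrec.id

theorem PrimrecPred.forall_mem {l : α → List β} {p : α → β → Prop} (hl : Primrec l)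
    (hp : PrimrecPred fun q : α × β => p q.1 q.2) : PrimrecPred fun a => ∀ b ∈ l a, p a b := by
  have h : PrimrecRel fun (b : β) (a : α) => p a b :=
    hp.comp (f := fun q : β × α => (q.2, q.1)) (by fun_prop)
  exact h.forall_mem_list.comp hl Primrec.id

theorem PrimrecPred.forall_lt' {n : α → ℕ} {p : α → ℕ → Prop} (hn : Primrec n)
    (hp : PrimrecPred fun q : α × ℕ => p q.1 q.2) : PrimrecPred fun a => ∀ i < n a, p a i :=
  (PrimrecPred.forall_mem (Primrec.list_range.comp hn) hp).of_eq fun a => by simp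

theorem PrimrecPred.exists_lt' {n : α → ℕ} {p : α → ℕ → Prop} (hn : Primrec n)
    (hp : PrimrecPred fun q : α × ℕ => p q.1 q.2) : PrimrecPred fun a => ∃ i < n a, p a i :=
  (PrimrecPred.exists_mem (Primrec.list_range.comp hn) hp).of_eq fun a => by simp

/-- Unbounded search. The test `p` is primitive recursive, while data that are merely computable
enter through `f`. -/
theorem exists_computable_choice {p : α → Prop} (hp : PrimrecPred p) {f : ℕ → ℕ → α}
    (hf : Computable₂ f) (h : ∀ n, ∃ e, p (f n e)) :
    ∃ s : ℕ → ℕ, Computable s ∧ ∀ n, p (f n (s n)) := by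
  classical
  refine ⟨fun n => Nat.find (h n), ?_, fun n => Nat.find_spec (h n)⟩
  have hd : Computable₂ fun n e => decide (p (f n e)) := hp.decide.to_comp.comp₂ hf
  refine (Partrec.rfind hd.partrec₂).of_eq fun n => ?_
  refine Part.eq_some_iff.2 (Nat.mem_rfind.2 ⟨?_, fun {m} hm => ?_⟩)
  · simpa using Nat.find_spec (h n)
  · simpa using Nat.find_min (h n) hm

end Primrec

/-! ### Decidability of traces -/

/-- The lattice point `g / 2 ^ m` lies in the neighborhood of size `r + 2 ^ (-m)` around the center
of a rational neighborhood of size `r` in the list `Q`. -/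
def NearCover (Q : List NbhdCode) (m : ℕ) (g : ℤ × ℤ) : Prop :=
  ∃ U ∈ Q,
    |g.1 * (U.1.1.2 + 1) * (U.2.2 + 1) - 2 ^ m * U.1.1.1 * (U.2.2 + 1)| <
      2 ^ m * U.2.1 * (U.1.1.2 + 1) + (U.1.1.2 + 1) * (U.2.2 + 1) ∧
    |g.2 * (U.1.2.2 + 1) * (U.2.2 + 1) - 2 ^ m * U.1.2.1 * (U.2.2 + 1)| <
      2 ^ m * U.2.1 * (U.1.2.2 + 1) + (U.1.2.2 + 1) * (U.2.2 + 1)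

/-- Lattice points in a box that are near the union of the cover `Q`. -/
def gridSet (R : ℕ) (Q : List NbhdCode) (m : ℕ) : Set (ℤ × ℤ) :=
  {g | |g.1| ≤ R * 2 ^ m ∧ |g.2| ≤ R * 2 ^ m ∧ NearCover Q m g}

/-- The number of lattice points on the side of a box. -/
def boxWidth (R m : ℕ) : ℕ := 2 * R * 2 ^ m + 1

/-- Sequences of lattice points in a box, coded by numbers. -/
def codePath (R m e i : ℕ) : ℤ × ℤ :=
  ((e / boxWidth R m ^ (2 * i) % boxWidth R m : ℕ) - R * 2 ^ m,
    (e / boxWidth R m ^ (2 * i + 1) % boxWidth R m : ℕ) - R * 2 ^ m)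

theorem exists_digits (W : ℕ) : ∀ (N : ℕ) (d : ℕ → ℕ), (∀ i < N, d i < W) →
    ∃ e < W ^ N, ∀ i < N, e / W ^ i % W = d i
  | 0, _, _ => ⟨0, by simp, by simp⟩
  | N + 1, d, hd => by
    obtain ⟨e, he, hed⟩ := exists_digits W N (fun i => d (i + 1)) fun i hi => hd _ (by omega)
    have h0 := hd 0 (by omega)
    refine ⟨d 0 + W * e, ?_, fun i hi => ?_⟩
    · calc d 0 + W * e < W + W * e := by omega
        _ = W * (e + 1) := by ring
        _ ≤ W * W ^ N := Nat.mul_le_mul_left _ he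
        _ = W ^ (N + 1) := by ring
    · rcases i with _ | i
      · simp [Nat.mod_eq_of_lt h0]
      · rw [pow_succ', ← Nat.div_div_eq_div_mul, Nat.add_mul_div_left _ _ (by omega),
          Nat.div_eq_of_lt h0, zero_add, hed i (by omega)]

/-- Two base-`boxWidth` digits per point, shifted to be nonnegative. This turns quantification over
all paths in the box into a bounded quantifier over numbers. -/
theorem exists_codePath {R m N : ℕ} {p : ℕ → ℤ × ℤ}
    (hp : ∀ i < N, |(p i).1| ≤ R * 2 ^ m ∧ |(p i).2| ≤ R * 2 ^ m) :
    ∃ e < boxWidth R m ^ (2 * N), ∀ i < N, codePath R m e i = p i := by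
  obtain ⟨e, he, hed⟩ := exists_digits (boxWidth R m) (2 * N)
    (fun j => if j % 2 = 0 then ((p (j / 2)).1 + R * 2 ^ m).toNat
      else ((p (j / 2)).2 + R * 2 ^ m).toNat) (fun j hj => by
      have h1 := hp (j / 2) (by omega)
      have hw : ((boxWidth R m : ℕ) : ℤ) = R * 2 ^ m + R * 2 ^ m + 1 := by
        simp only [boxWidth]; push_cast; ring
      rw [abs_le, abs_le] at h1
      generalize (R : ℤ) * 2 ^ m = B at *
      split_ifs <;> omega)
  refine ⟨e, he, fun i hi => ?_⟩
  have h1 := hed (2 * i) (by omega)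
  have h2 := hed (2 * i + 1) (by omega)
  rw [if_pos (by omega), show 2 * i / 2 = i by omega] at h1
  rw [if_neg (by omega), show (2 * i + 1) / 2 = i by omega] at h2
  have h3 := hp i hi
  rw [abs_le, abs_le] at h3
  rw [codePath, h1, h2]
  generalize (R : ℤ) * 2 ^ m = B at *
  ext <;> simp only <;> omega

section

variable {α : Type*} [Primcodable α]

theorem primrecPred_nearCover {Q : α → List NbhdCode} {m : α → ℕ} {g : α → ℤ × ℤ}
    (hQ : Primrec Q) (hm : Primrec m) (hg : Primrec g) :
    PrimrecPred fun a => NearCover (Q a) (m a) (g a) := by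
  unfold NearCover
  refine PrimrecPred.exists_mem hQ ?_
  fun_prop

@[fun_prop]
theorem primrecPred_mem_gridSet {Q : α → List NbhdCode} {m : α → ℕ} {g : α → ℤ × ℤ} (R : ℕ)
    (hQ : Primrec Q) (hm : Primrec m) (hg : Primrec g) :
    PrimrecPred fun a => g a ∈ gridSet R (Q a) (m a) := by
  have := primrecPred_nearCover hQ hm hg
  unfold gridSet
  simp only [mem_ofPred_eq]
  fun_prop

@[fun_prop]
theorem primrec_boxWidth {m : α → ℕ} (R : ℕ) (hm : Primrec m) :
    Primrec fun a => boxWidth R (m a) := by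
  unfold boxWidth
  fun_prop

@[fun_prop]
theorem primrec_codePath {m e i : α → ℕ} (R : ℕ) (hm : Primrec m) (he : Primrec e)
    (hi : Primrec i) : Primrec fun a => codePath R (m a) (e a) (i a) := by
  unfold codePath
  fun_prop

theorem forall_mem_gridSet_iff {R : ℕ} {Q : List NbhdCode} {m : ℕ} {p : ℤ × ℤ → Prop} :
    (∀ g ∈ gridSet R Q m, p g) ↔ ∀ x < boxWidth R m, ∀ y < boxWidth R m,
      ((x : ℤ) - R * 2 ^ m, (y : ℤ) - R * 2 ^ m) ∈ gridSet R Q m →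
        p ((x : ℤ) - R * 2 ^ m, (y : ℤ) - R * 2 ^ m) := by
  refine ⟨fun h x _ y _ hg => h _ hg, fun h g hg => ?_⟩
  have h1 := abs_le.1 hg.1
  have h2 := abs_le.1 hg.2.1
  have hw : ((boxWidth R m : ℕ) : ℤ) = R * 2 ^ m + R * 2 ^ m + 1 := by
    simp only [boxWidth]; push_cast; ring
  have h3 := h (g.1 + R * 2 ^ m).toNat (by generalize (R : ℤ) * 2 ^ m = B at *; omega)
    (g.2 + R * 2 ^ m).toNat (by generalize (R : ℤ) * 2 ^ m = B at *; omega)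
  have e1 : (((g.1 + R * 2 ^ m).toNat : ℕ) : ℤ) - R * 2 ^ m = g.1 := by
    generalize (R : ℤ) * 2 ^ m = B at *; omega
  have e2 : (((g.2 + R * 2 ^ m).toNat : ℕ) : ℤ) - R * 2 ^ m = g.2 := by
    generalize (R : ℤ) * 2 ^ m = B at *; omega
  rw [e1, e2] at h3
  exact h3 hg

theorem primrecPred_lattice_lip {x y x' y' : α → ℤ} {l m i j : α → ℕ} (hx : Primrec x)
    (hy : Primrec y) (hx' : Primrec x') (hy' : Primrec y') (hl : Primrec l) (hm : Primrec m)
    (hi : Primrec i) (hj : Primrec j) :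
    PrimrecPred fun a => 4 ^ m a * ((x a - x' a) ^ 2 + (y a - y' a) ^ 2) ≤
      ((l a : ℤ) * |(i a : ℤ) - j a| + 3 * 2 ^ m a) ^ 2 := by
  fun_prop

theorem primrecPred_abs_sub_le {x y x' y' : α → ℤ} (c : ℕ) (hx : Primrec x) (hy : Primrec y)
    (hx' : Primrec x') (hy' : Primrec y') :
    PrimrecPred fun a => |x a - x' a| ≤ c ∧ |y a - y' a| ≤ c := by
  fun_prop

theorem primrecPred_isTrace_lip {l m e : α → ℕ} (R : ℕ) (hl : Primrec l) (hm : Primrec m)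
    (he : Primrec e) :
    PrimrecPred fun a => ∀ i < 2 ^ m a + 1, ∀ j < 2 ^ m a + 1,
      4 ^ m a * (((codePath R (m a) (e a) i).1 - (codePath R (m a) (e a) j).1) ^ 2 +
        ((codePath R (m a) (e a) i).2 - (codePath R (m a) (e a) j).2) ^ 2) ≤
      ((l a : ℤ) * |(i : ℤ) - j| + 3 * 2 ^ m a) ^ 2 :=
  PrimrecPred.forall_lt' (by fun_prop) (PrimrecPred.forall_lt' (by fun_prop)
    (primrecPred_lattice_lip (by fun_prop) (by fun_prop) (by fun_prop) (by fun_prop)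
      (by fun_prop) (by fun_prop) (by fun_prop) (by fun_prop)))

theorem primrecPred_isTrace_dense {Q : α → List NbhdCode} {m e : α → ℕ} (R c : ℕ)
    (hQ : Primrec Q) (hm : Primrec m) (he : Primrec e) :
    PrimrecPred fun a => ∀ g ∈ gridSet R (Q a) (m a), ∃ i < 2 ^ m a + 1,
      |g.1 - (codePath R (m a) (e a) i).1| ≤ c ∧ |g.2 - (codePath R (m a) (e a) i).2| ≤ c := by
  refine PrimrecPred.of_eq ?_ fun a => (forall_mem_gridSet_iff (p := fun g : ℤ × ℤ =>
    ∃ i < 2 ^ m a + 1, |g.1 - (codePath R (m a) (e a) i).1| ≤ c ∧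
      |g.2 - (codePath R (m a) (e a) i).2| ≤ c)).symm
  refine PrimrecPred.forall_lt' (by fun_prop) (PrimrecPred.forall_lt' (by fun_prop)
    (PrimrecPred.imp (by fun_prop) (PrimrecPred.exists_lt' (by fun_prop) ?_)))
  exact primrecPred_abs_sub_le c (by fun_prop) (by fun_prop) (by fun_prop) (by fun_prop)

theorem primrecPred_isTrace {Q : α → List NbhdCode} {l m e : α → ℕ} (R c k : ℕ) (b : ℤ × ℤ)
    (hQ : Primrec Q) (hl : Primrec l) (hm : Primrec m) (he : Primrec e) :
    PrimrecPred fun a => IsTrace (gridSet R (Q a) (m a)) (l a) c k b (m a)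
      (codePath R (m a) (e a)) := by
  have h1 : PrimrecPred fun a => ∀ i < 2 ^ m a + 1,
      codePath R (m a) (e a) i ∈ gridSet R (Q a) (m a) :=
    PrimrecPred.forall_lt' (by fun_prop) (by fun_prop)
  have h4 : PrimrecPred fun a =>
      |2 ^ k * (codePath R (m a) (e a) 0).1 - 2 ^ m a * b.1| ≤ 2 ^ m a + 2 ^ k ∧
      |2 ^ k * (codePath R (m a) (e a) 0).2 - 2 ^ m a * b.2| ≤ 2 ^ m a + 2 ^ k := by
    fun_prop
  exact (h1.and ((primrecPred_isTrace_lip R hl hm he).and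
    ((primrecPred_isTrace_dense R c hQ hm he).and h4))).of_eq fun a =>
      ⟨fun h => ⟨h.1, h.2.1, h.2.2.1, h.2.2.2⟩, fun h => ⟨h.mem, h.lip, h.dense, h.start⟩⟩

/-- The path coded by `e` is a trace, and all traces on the same lattice are `2 ^ (-n)`-close
to it. -/
def IsSharpTrace (S : Set (ℤ × ℤ)) (ℓ R c k : ℕ) (b : ℤ × ℤ) (n m e : ℕ) : Prop :=
  n ≤ m ∧ IsTrace S ℓ c k b m (codePath R m e) ∧
    ∀ d < boxWidth R m ^ (2 * (2 ^ m + 1)), IsTrace S ℓ c k b m (codePath R m d) →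
      ∀ i < 2 ^ m + 1, 2 ^ n * |(codePath R m e i).1 - (codePath R m d i).1| ≤ 2 ^ m ∧
        2 ^ n * |(codePath R m e i).2 - (codePath R m d i).2| ≤ 2 ^ m

theorem primrecPred_isSharpTrace {Q : α → List NbhdCode} {l n m e : α → ℕ} (R c k : ℕ)
    (b : ℤ × ℤ) (hQ : Primrec Q) (hl : Primrec l) (hn : Primrec n) (hm : Primrec m)
    (he : Primrec e) :
    PrimrecPred fun a => IsSharpTrace (gridSet R (Q a) (m a)) (l a) R c k b (n a) (m a) (e a) := by
  refine PrimrecPred.and (by fun_prop) (PrimrecPred.and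
    (primrecPred_isTrace R c k b hQ hl hm he) ?_)
  refine PrimrecPred.forall_lt' (by fun_prop) (PrimrecPred.imp
    (primrecPred_isTrace R c k b (by fun_prop) (by fun_prop) (by fun_prop) (by fun_prop)) ?_)
  exact PrimrecPred.forall_lt' (by fun_prop) (by fun_prop)

end

/-! ### Names -/

theorem IsName.abs_sub_le {φ : ℕ → RatCode} {x : ℝ} (h : IsName φ x) (n : ℕ) :
    |(φ n).val - x| ≤ 2 / 2 ^ n := by
  have := dist_le_of_le_geometric_two_of_tendsto (f := fun n => (φ n).val) (C := 2) (a := x)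
    (fun n => by
      rw [Real.dist_eq]
      refine (h.1 n).trans_eq ?_
      rw [div_self two_ne_zero, one_div, one_div, inv_pow]) h.2 n
  rwa [Real.dist_eq] at this

theorem isName_of_abs_sub_le {ψ : ℕ → RatCode} {x : ℝ}
    (h : ∀ n, |(ψ n).val - x| ≤ 1 / 2 / 2 ^ n) : IsName ψ x := by
  constructor
  · intro n
    have h1 := abs_le.1 (h n)
    have h2 := abs_le.1 (h (n + 1))
    have h3 : (1 : ℝ) / 2 / 2 ^ (n + 1) ≤ 1 / 2 / 2 ^ n := by
      gcongr
      · norm_num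
      · omega
    have h4 : (1 / 2 : ℝ) ^ n = 1 / 2 / 2 ^ n + 1 / 2 / 2 ^ n := by
      rw [div_pow, one_pow]; ring
    rw [h4, abs_le]
    constructor <;> linarith
  · rw [tendsto_iff_dist_tendsto_zero]
    exact squeeze_zero (fun _ => dist_nonneg) (fun n => by rw [Real.dist_eq]; exact h n)
      (tendsto_const_div_two_pow le_rfl (1 / 2))

/-- An integer approximation of `2 ^ m` times a positive number from a name of the number. -/
theorem exists_computable_bound {x : ℝ} (hx : 0 < x) (hc : IsComputableReal x) :
    ∃ ℓ : ℕ → ℕ, Computable ℓ ∧ ∀ m, x * 2 ^ m ≤ ℓ m ∧ (ℓ m : ℝ) ≤ x * 2 ^ m + 5 := by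
  obtain ⟨φ, hφ, hφx⟩ := hc
  -- The `m`-th term of a name, times `2 ^ m`, is off by at most `2`, and integer division loses
  -- less than `1`; adding `3` gives an upper bound with excess at most `5`.
  have hp : Primrec fun q : RatCode × ℕ => q.1.1.toNat * 2 ^ q.2 / (q.1.2 + 1) + 3 := by fun_prop
  refine ⟨fun m => (φ m).1.toNat * 2 ^ m / ((φ m).2 + 1) + 3,
    (hp.to_comp.comp (Computable.pair hφ Computable.id) :), fun m => ?_⟩
  have hm : (0 : ℝ) < 2 ^ m := by positivity
  have h1 := abs_le.1 (hφx.abs_sub_le m)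
  beta_reduce
  generalize φ m = q at *
  have hd : (0 : ℝ) < (q.2 : ℝ) + 1 := by positivity
  have h2 := Nat.floor_div_eq_div (K := ℝ) (q.1.toNat * 2 ^ m) (q.2 + 1)
  push_cast at h2
  set y : ℝ := (q.1.toNat : ℝ) * 2 ^ m / (q.2 + 1) with hy
  have hy0 : 0 ≤ y := by positivity
  have h3 := Nat.floor_le hy0
  have h4 := Nat.lt_floor_add_one y
  rw [h2] at h3 h4
  have e1 : q.val * 2 ^ m = (q.1 : ℝ) * 2 ^ m / (q.2 + 1) := by
    rw [RatCode.val]; ring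
  have e2 : q.val * 2 ^ m ≤ y := by
    rw [e1, hy]
    have : (q.1 : ℝ) ≤ q.1.toNat := by exact_mod_cast Int.self_le_toNat _
    gcongr
  have e3 : y ≤ x * 2 ^ m + 2 := by
    have e5 : 0 ≤ x * 2 ^ m := by positivity
    rcases le_total 0 q.1 with h0 | h0
    · have : y = q.val * 2 ^ m := by
        rw [e1, hy]
        have : ((q.1.toNat : ℕ) : ℝ) = q.1 := by exact_mod_cast Int.toNat_of_nonneg h0
        rw [this]
      rw [this]
      have := mul_le_mul_of_nonneg_right h1.2 hm.le
      rw [div_mul_cancel₀ _ hm.ne'] at this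
      linarith
    · rw [hy, Int.toNat_of_nonpos h0]; simp; linarith
  have e4 := mul_le_mul_of_nonneg_right h1.1 hm.le
  rw [neg_mul, div_mul_cancel₀ _ hm.ne'] at e4
  push_cast at *
  constructor <;> linarith

/-! ### Machines that look up a table -/

/-- A Lipschitz function on the unit interval is computable if a computable function `T` gives its
values up to `2 ^ (-n)` on grids of mesh at most `2 ^ (-n)`. -/
theorem isComputableFun_of_table {g : I → ℝ} {L : ℝ} (hg : ∀ s t : I, |g s - g t| ≤ L * |(s : ℝ) - t|)
    {s : ℕ → ℕ} (hs : Computable s) {mesh : ℕ → ℕ} (hmesh : Primrec mesh)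
    {T : ℕ → ℕ → RatCode} (hT : Primrec₂ T) (hn : ∀ n, n ≤ mesh (s n))
    (happ : ∀ n, ∀ i ≤ 2 ^ mesh (s n), |(T (s n) i).val - g (grid (mesh (s n)) i)| ≤ 2 / 2 ^ n) :
    IsComputableFun g := by
  -- Working at precision `n + b` absorbs the Lipschitz constant and the table error, leaving at
  -- most `1 / 2 / 2 ^ n`.
  obtain ⟨b, hb⟩ : ∃ b : ℕ, 2 * (2 * |L| + 2) ≤ 2 ^ b := by
    obtain ⟨b, hb⟩ := pow_unbounded_of_one_lt (2 * (2 * |L| + 2)) (one_lt_two (α := ℝ))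
    exact ⟨b, hb.le⟩
  -- An approximation of `x` may leave the unit interval; `toNat` and `min` clamp it, which does not
  -- increase its distance from `x`.
  let idx : ℕ → RatCode → ℕ := fun e x => min (x.1.toNat * 2 ^ mesh e / (x.2 + 1)) (2 ^ mesh e)
  have hidx : Primrec fun q : ℕ × RatCode => idx q.1 q.2 := by
    simp only [idx]; fun_prop
  let out : ℕ → RatCode → RatCode := fun e x => T e (idx e x)
  have hout : Primrec fun q : ℕ × RatCode => out q.1 q.2 := hT.comp Primrec.fst hidx
  refine ⟨fun w n => (w[n + b + 1]?).map (out (s (n + b))), ?_, fun x φ hφ => ?_⟩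
  · have h1 : Computable fun q : List RatCode × ℕ => q.1[q.2 + b + 1]? :=
      Computable.list_getElem?.comp Computable.fst
        ((by fun_prop : Primrec fun q : List RatCode × ℕ => q.2 + b + 1).to_comp)
    refine Computable.option_map h1 ?_
    have h2 : Computable fun q : (List RatCode × ℕ) × RatCode => s (q.1.2 + b) :=
      hs.comp ((by fun_prop : Primrec fun q : (List RatCode × ℕ) × RatCode => q.1.2 + b).to_comp)
    exact (hout.to_comp.comp (Computable.pair h2 Computable.snd) :)
  · refine ⟨fun n => out (s (n + b)) (φ (n + b + 1)), isName_of_abs_sub_le fun n => ?_, fun n => ⟨?_, ?_⟩⟩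
    · set e := s (n + b)
      set m := mesh e
      have hm : (0 : ℝ) < 2 ^ m := by positivity
      have hφ1 := hφ.abs_sub_le (n + b + 1)
      set q := φ (n + b + 1)
      have hN : (2 : ℝ) / 2 ^ (n + b + 1) = 1 / 2 ^ (n + b) := by
        rw [pow_succ]; field_simp
      rw [hN] at hφ1
      have hmN : (1 : ℝ) / 2 ^ m ≤ 1 / 2 ^ (n + b) := by
        gcongr
        · norm_num
        · exact hn (n + b)
      have hile : idx e q ≤ 2 ^ m := min_le_right _ _
      have h1 := happ (n + b) (idx e q) hile
      have h2 : |(x : ℝ) - grid m (idx e q)| ≤ 2 / 2 ^ (n + b) := by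
        rw [coe_grid hile]
        have h3 := Nat.floor_div_eq_div (K := ℝ) (q.1.toNat * 2 ^ m) (q.2 + 1)
        push_cast at h3
        set y : ℝ := (q.1.toNat : ℝ) * 2 ^ m / (q.2 + 1) with hy
        have hy0 : 0 ≤ y := by positivity
        have h4 := Nat.floor_le hy0
        have h5 := Nat.lt_floor_add_one y
        rw [h3] at h4 h5
        have hx0 := x.2.1
        have hx1 := x.2.2
        have hq := abs_le.1 hφ1
        have hyq : |y / 2 ^ m - x| ≤ 1 / 2 ^ (n + b) := by
          have e1 : y / 2 ^ m = (q.1.toNat : ℝ) / (q.2 + 1) := by rw [hy]; field_simp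
          rw [e1]
          rcases le_total 0 q.1 with h0 | h0
          · have e2 : ((q.1.toNat : ℕ) : ℝ) = q.1 := by exact_mod_cast Int.toNat_of_nonneg h0
            rw [e2]; exact hφ1
          · have e2 : q.val ≤ 0 := by
              rw [RatCode.val]
              exact div_nonpos_of_nonpos_of_nonneg (by exact_mod_cast h0) (by positivity)
            rw [Int.toNat_of_nonpos h0, abs_le]
            simp only [Nat.cast_zero, zero_div]
            constructor <;> linarith
        have hyq' := abs_le.1 hyq
        have h6 : ((q.1.toNat * 2 ^ m / (q.2 + 1) : ℕ) : ℝ) / 2 ^ m ≤ y / 2 ^ m := by gcongr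
        have h7 : y / 2 ^ m ≤ ((q.1.toNat * 2 ^ m / (q.2 + 1) : ℕ) : ℝ) / 2 ^ m + 1 / 2 ^ m := by
          rw [← add_div]; gcongr
        have h8 : (2 : ℝ) / 2 ^ (n + b) = 1 / 2 ^ (n + b) + 1 / 2 ^ (n + b) := by ring
        rw [h8]
        simp only [idx]
        rcases le_total (q.1.toNat * 2 ^ m / (q.2 + 1)) (2 ^ m) with hle | hle
        · rw [min_eq_left hle, abs_le]
          constructor <;> linarith
        · rw [min_eq_right hle]
          have h9 : (1 : ℝ) ≤ ((q.1.toNat * 2 ^ m / (q.2 + 1) : ℕ) : ℝ) / 2 ^ m := by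
            rw [le_div_iff₀ hm, one_mul]; exact_mod_cast hle
          have h10 : ((2 ^ m : ℕ) : ℝ) / 2 ^ m = 1 := by push_cast; exact div_self hm.ne'
          rw [h10, abs_le]
          constructor <;> linarith
      have h3 := hg x (grid m (idx e q))
      have h4 : L * |(x : ℝ) - grid m (idx e q)| ≤ |L| * (2 / 2 ^ (n + b)) := by
        gcongr
        exact le_abs_self L
      calc |(T e (idx e q)).val - g x|
          ≤ |(T e (idx e q)).val - g (grid m (idx e q))| + |g (grid m (idx e q)) - g x| :=
            abs_sub_le _ _ _
        _ ≤ 2 / 2 ^ (n + b) + |L| * (2 / 2 ^ (n + b)) := by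
            rw [abs_sub_comm (g (grid m (idx e q)))]
            exact add_le_add h1 (h3.trans h4)
        _ = (2 * |L| + 2) / 2 ^ b / 2 ^ n := by rw [pow_add]; field_simp; ring
        _ ≤ 1 / 2 / 2 ^ n := by
            refine div_le_div_of_nonneg_right ?_ (by positivity)
            rw [div_le_div_iff₀ (by positivity) (by norm_num)]
            linarith
    · exact ⟨n + b + 2, by simp⟩
    · intro k q hq
      simp only [List.getElem?_map, Option.map_map, Option.map_eq_some_iff] at hq
      obtain ⟨j, hj, hjq⟩ := hq
      rw [List.getElem?_eq_some_iff] at hj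
      obtain ⟨hjk, hj⟩ := hj
      simp only [List.getElem_range] at hj
      rw [← hjq, ← hj]; rfl

/-! ### From compact covers to the arc length parametrization -/

/-- The number `s n` found by search codes a pair of a lattice level and a sharp trace on it; the
table of values of `F` is read off that trace. -/
theorem TraceData.isComputablePath {F : I → Plane} {C : Set Plane} {L : ℝ}
    {Q : ℕ → List NbhdCode} {ℓ : ℕ → ℕ} {R c k : ℕ} {a : ℤ × ℤ}
    (h : TraceData F C L (fun m => gridSet R (Q m) m) ℓ c k a) (hQ : Computable Q)
    (hℓ : Computable ℓ) : IsComputablePath F := by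
  have hfloor : ∀ m, ∃ d < boxWidth R m ^ (2 * (2 ^ m + 1)), ∀ i < 2 ^ m + 1,
      codePath R m d i = latticeFloor m (F (grid m i)) := fun m =>
    exists_codePath fun i hi => by
      have := (h.isTrace_floor m).mem i hi
      exact ⟨this.1, this.2.1⟩
  have hcongr : ∀ {m : ℕ} {p p' : ℕ → ℤ × ℤ}, (∀ i < 2 ^ m + 1, p i = p' i) →
      IsTrace (gridSet R (Q m) m) (ℓ m) c k a m p' → IsTrace (gridSet R (Q m) m) (ℓ m) c k a m p := by
    intro m p p' hpp hp
    refine ⟨fun i hi => ?_, fun i hi j hj => ?_, fun g hg => ?_, ?_⟩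
    · rw [hpp i hi]; exact hp.mem i hi
    · rw [hpp i hi, hpp j hj]; exact hp.lip i hi j hj
    · obtain ⟨i, hi, h⟩ := hp.dense g hg
      exact ⟨i, hi, by rwa [hpp i hi]⟩
    · rw [hpp 0 (Nat.succ_pos _)]; exact hp.start
  have hcoord : ∀ {m : ℕ} {x y : ℤ} {n : ℕ}, 2 ^ n * |x - y| ≤ 2 ^ m ↔
      |(x : ℝ) / 2 ^ m - y / 2 ^ m| ≤ 1 / 2 ^ n := by
    intro m x y n
    have hm : (0 : ℝ) < 2 ^ m := by positivity
    rw [← sub_div, abs_div, abs_of_pos hm, div_le_div_iff₀ hm (by positivity), one_mul, mul_comm,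
      ← Int.cast_le (R := ℝ)]
    push_cast
    rfl
  obtain ⟨s, hs, hsharp⟩ := exists_computable_choice
    (p := fun q : (List NbhdCode × ℕ) × ℕ × ℕ × ℕ =>
      IsSharpTrace (gridSet R q.1.1 q.2.2.1) q.1.2 R c k a q.2.1 q.2.2.1 q.2.2.2)
    (f := fun n e => ((Q e.unpair.1, ℓ e.unpair.1), n, e.unpair.1, e.unpair.2))
    (primrecPred_isSharpTrace R c k a (by fun_prop) (by fun_prop) (by fun_prop) (by fun_prop)
      (by fun_prop))
    (by
      have h1 : Computable fun q : ℕ × ℕ => q.2.unpair.1 :=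
        (by fun_prop : Primrec fun q : ℕ × ℕ => q.2.unpair.1).to_comp
      have h2 : Computable fun q : ℕ × ℕ => q.2.unpair.2 :=
        (by fun_prop : Primrec fun q : ℕ × ℕ => q.2.unpair.2).to_comp
      exact Computable.pair (Computable.pair (hQ.comp h1) (hℓ.comp h1))
        (Computable.pair Computable.fst (Computable.pair h1 h2)))
    (by
      intro n
      -- The search ends: once all traces are within half of `2 ^ (-n)` of `F`, they are `2 ^
      -- (-n)`-close to each other, and rounded `F` is one of them.
      obtain ⟨m, hmn, hm⟩ := ((eventually_ge_atTop n).and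
        (h.eventually_dist_le (ε := 1 / 2 / 2 ^ n) (by positivity))).exists
      obtain ⟨d, -, hd⟩ := hfloor m
      have hdt := hcongr hd (h.isTrace_floor m)
      refine ⟨Nat.pair m d, ?_⟩
      simp only [Nat.unpair_pair]
      refine ⟨hmn, hdt, fun d' _ hd' i hi => ?_⟩
      have e1 := hm _ hdt i (by omega)
      have e2 := hm _ hd' i (by omega)
      have e3 : ∀ q : Fin 2, |latticePt m (codePath R m d i) q - latticePt m (codePath R m d' i) q| ≤
          1 / 2 ^ n := fun q => by
        refine (abs_coord_sub_le _ _ q).trans ((dist_triangle_right _ _ (F (grid m i))).trans ?_)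
        refine (add_le_add e1 e2).trans_eq (by ring)
      exact ⟨hcoord.2 (e3 0), hcoord.2 (e3 1)⟩)
  -- Sharpness compares the trace found with rounded `F`, and `n ≤ m` bounds the rounding; each
  -- contributes `2 ^ (-n)`.
  have happ : ∀ (n : ℕ) (q : Fin 2), ∀ i ≤ 2 ^ (s n).unpair.1,
      |latticePt (s n).unpair.1 (codePath R (s n).unpair.1 (s n).unpair.2 i) q -
        F (grid (s n).unpair.1 i) q| ≤ 2 / 2 ^ n := by
    intro n q i hi
    obtain ⟨hnm, -, hall⟩ := hsharp n
    simp only at hnm hall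
    generalize (s n).unpair.1 = m at *
    generalize (s n).unpair.2 = e at *
    obtain ⟨d, hdlt, hd⟩ := hfloor m
    have h1 := hall d hdlt (hcongr hd (h.isTrace_floor m)) i (by omega)
    rw [hd i (by omega), hcoord, hcoord] at h1
    have hm : (0 : ℝ) < 2 ^ m := by positivity
    have h2 : |latticePt m (latticeFloor m (F (grid m i))) q - F (grid m i) q| ≤ 1 / 2 ^ n := by
      have key : ∀ x : ℝ, |(⌊2 ^ m * x⌋ : ℝ) / 2 ^ m - x| ≤ 1 / 2 ^ n := by
        intro x
        have h1 := Int.floor_le (2 ^ m * x)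
        have h2 := Int.lt_floor_add_one (2 ^ m * x)
        have h3 : (⌊2 ^ m * x⌋ : ℝ) / 2 ^ m - x = (⌊2 ^ m * x⌋ - 2 ^ m * x) / 2 ^ m := by field_simp
        have h4 : (1 : ℝ) / 2 ^ m ≤ 1 / 2 ^ n := by
          gcongr
          norm_num
        refine le_trans ?_ h4
        rw [h3, abs_div, abs_of_pos hm, div_le_div_iff_of_pos_right hm, abs_le]
        constructor <;> linarith
      fin_cases q <;> exact key _
    have h3 : |latticePt m (codePath R m e i) q - latticePt m (latticeFloor m (F (grid m i))) q| ≤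
        1 / 2 ^ n := by
      fin_cases q
      exacts [h1.1, h1.2]
    calc _ ≤ _ := abs_sub_le _ (latticePt m (latticeFloor m (F (grid m i))) q) _
      _ ≤ 1 / 2 ^ n + 1 / 2 ^ n := add_le_add h3 h2
      _ = 2 / 2 ^ n := by ring
  have hval : ∀ (z : ℤ) (m : ℕ), RatCode.val (z, 2 ^ m - 1) = (z : ℝ) / 2 ^ m := by
    intro z m
    have : ((2 ^ m - 1 : ℕ) : ℝ) + 1 = 2 ^ m := by
      rw [Nat.cast_sub Nat.one_le_two_pow]; push_cast; ring
    rw [RatCode.val, this]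
  have hlip : ∀ (q : Fin 2) (s t : I), |F s q - F t q| ≤ L * |(s : ℝ) - t| := fun q s t =>
    (abs_coord_sub_le _ _ q).trans (h.arc.dist_le s t)
  have hmesh : Primrec fun e : ℕ => e.unpair.1 := by fun_prop
  intro q
  fin_cases q
  · refine isComputableFun_of_table (hlip 0) hs hmesh
      (T := fun e i => ((codePath R e.unpair.1 e.unpair.2 i).1, 2 ^ e.unpair.1 - 1)) ?_
      (fun n => (hsharp n).1) fun n i hi => ?_
    · unfold Primrec₂; fun_prop
    · rw [hval]; exact happ n 0 i hi
  · refine isComputableFun_of_table (hlip 1) hs hmesh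
      (T := fun e i => ((codePath R e.unpair.1 e.unpair.2 i).2, 2 ^ e.unpair.1 - 1)) ?_
      (fun n => (hsharp n).1) fun n i hi => ?_
    · unfold Primrec₂; fun_prop
    · rw [hval]; exact happ n 1 i hi

/-! ### Trace data from compact covers -/

theorem exists_mem_of_dH_lt {A B : Set Plane} {δ : ℝ} (h : dH A B < ENNReal.ofReal δ) {w : Plane}
    (hw : w ∈ A) : ∃ z ∈ B, |w 0 - z 0| < δ ∧ |w 1 - z 1| < δ := by
  simp only [dH, iInf_lt_iff] at h
  obtain ⟨ε, ⟨hε, hAB, -⟩, hlt⟩ := h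
  have hεδ : ε < δ := (ENNReal.ofReal_lt_ofReal_iff_of_nonneg hε.le).1 hlt
  obtain ⟨z, hz, h0, h1⟩ : ∃ z ∈ B, w ∈ nbhd ε z := by simpa [nbhdSet] using hAB hw
  exact ⟨z, hz, h0.trans hεδ, h1.trans hεδ⟩

theorem near_coord_iff (m : ℕ) (x : ℤ) (u r : RatCode) :
    |x * (u.2 + 1) * (r.2 + 1) - 2 ^ m * u.1 * (r.2 + 1)| <
      2 ^ m * r.1 * (u.2 + 1) + (u.2 + 1) * (r.2 + 1) ↔
    |(x : ℝ) / 2 ^ m - u.val| < r.val + 1 / 2 ^ m := by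
  have hu : (0 : ℝ) < (u.2 : ℝ) + 1 := by positivity
  have hr : (0 : ℝ) < (r.2 : ℝ) + 1 := by positivity
  have hm : (0 : ℝ) < 2 ^ m := by positivity
  set P : ℝ := 2 ^ m * (u.2 + 1) * (r.2 + 1) with hP
  have hP0 : 0 < P := by positivity
  have e1 : (x : ℝ) * (u.2 + 1) * (r.2 + 1) - 2 ^ m * u.1 * (r.2 + 1) =
      ((x : ℝ) / 2 ^ m - u.val) * P := by
    rw [RatCode.val, hP]; field_simp
  have e2 : (2 : ℝ) ^ m * r.1 * (u.2 + 1) + (u.2 + 1) * (r.2 + 1) = (r.val + 1 / 2 ^ m) * P := by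
    rw [RatCode.val, hP]; field_simp
  rw [← Int.cast_lt (R := ℝ)]
  push_cast
  rw [e1, e2, abs_mul, abs_of_pos hP0, mul_lt_mul_iff_left₀ hP0]

/-- Contract `x` towards `u` by the factor `r / (r + δ)`. This moves a lattice point of the enlarged
square into the square itself. -/
theorem exists_between_of_abs_sub_lt {x u r δ : ℝ} (hr : 0 < r) (hδ : 0 < δ)
    (h : |x - u| < r + δ) : ∃ w, |w - u| < r ∧ |x - w| ≤ δ := by
  have hs : 0 < r + δ := by positivity
  refine ⟨u + (x - u) * (r / (r + δ)), ?_, ?_⟩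
  · rw [add_sub_cancel_left, abs_mul, abs_of_pos (by positivity : 0 < r / (r + δ))]
    calc |x - u| * (r / (r + δ)) < (r + δ) * (r / (r + δ)) := by gcongr
      _ = r := by field_simp
  · have e : x - (u + (x - u) * (r / (r + δ))) = (x - u) * (δ / (r + δ)) := by field_simp; ring
    rw [e, abs_mul, abs_of_pos (by positivity : 0 < δ / (r + δ))]
    calc |x - u| * (δ / (r + δ)) ≤ (r + δ) * (δ / (r + δ)) := by gcongr
      _ = δ := by field_simp

/-- If both points passed the test, their distance would be at most `4 / 2 ^ k`. The pair `k, a` is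
the finite advice that tells the two ends of the arc apart. -/
theorem exists_start {z w : Plane} (h : z ≠ w) : ∃ (k : ℕ) (a : ℤ × ℤ),
    (|2 ^ k * z 0 - a.1| ≤ 1 ∧ |2 ^ k * z 1 - a.2| ≤ 1) ∧
    ¬ (|2 ^ k * w 0 - a.1| ≤ 1 ∧ |2 ^ k * w 1 - a.2| ≤ 1) := by
  have hd : 0 < dist z w := dist_pos.2 h
  obtain ⟨k, hk⟩ := pow_unbounded_of_one_lt (4 / dist z w) (one_lt_two (α := ℝ))
  rw [div_lt_iff₀ hd] at hk
  have hk0 : (0 : ℝ) < 2 ^ k := by positivity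
  have hfl : ∀ x : ℝ, |2 ^ k * x - ⌊2 ^ k * x⌋| ≤ 1 := fun x => by
    rw [abs_le]
    constructor <;> linarith [Int.floor_le (2 ^ k * x), Int.lt_floor_add_one (2 ^ k * x)]
  refine ⟨k, latticeFloor k z, ⟨hfl _, hfl _⟩, fun ⟨h0, h1⟩ => ?_⟩
  have key : ∀ q, |2 ^ k * w q - ⌊2 ^ k * z q⌋| ≤ 1 → 2 ^ k * |z q - w q| ≤ 2 := by
    intro q hq
    have e : 2 ^ k * |z q - w q| = |2 ^ k * z q - 2 ^ k * w q| := by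
      rw [← mul_sub, abs_mul, abs_of_pos hk0]
    have h2 := abs_le.1 (hfl (z q))
    have h3 := abs_le.1 hq
    rw [e, abs_le]
    constructor <;> linarith
  have h2 := mul_le_mul_of_nonneg_left (plane_dist_le z w) hk0.le
  rw [mul_add] at h2
  linarith [key 0 h0, key 1 h1]

theorem KComputable.isComputablePath {C : Set Plane} {F : I → Plane} {L : ℝ} (hK : KComputable C)
    (hF : IsArcParam F C L) (hL : IsComputableReal L) : IsComputablePath F := by
  obtain ⟨Q, hQ, hQn⟩ := hK
  obtain ⟨ℓ, hℓ, hℓL⟩ := exists_computable_bound hF.pos hL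
  obtain ⟨k, a, hst, hend⟩ := exists_start (hF.inj.2.1.ne zero_ne_one : F 0 ≠ F 1)
  have hCcomp : IsCompact C := by
    rw [← hF.inj.2.2]; exact isCompact_range hF.inj.1
  obtain ⟨B, hB⟩ := hCcomp.isBounded.subset_closedBall (0 : Plane)
  obtain ⟨R, hR⟩ := exists_nat_ge B
  have hbox : ∀ (m : ℕ), ∀ z ∈ C, ∀ q : Fin 2, |⌊2 ^ m * z q⌋| ≤ (R : ℤ) * 2 ^ m := by
    intro m z hz q
    have hm : (0 : ℝ) < 2 ^ m := by positivity
    have h1 : |z q| ≤ R := by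
      have h2 := abs_coord_sub_le z 0 q
      have h3 : dist z 0 ≤ B := hB hz
      simp only [PiLp.zero_apply, sub_zero] at h2
      linarith
    have h2 : |2 ^ m * z q| ≤ R * 2 ^ m := by
      rw [abs_mul, abs_of_pos hm, mul_comm]; gcongr
    rw [abs_le] at h2 ⊢
    constructor
    · rw [Int.le_floor]; push_cast; exact h2.1
    · rw [← Int.floor_intCast (R := ℝ) (R * 2 ^ m)]
      apply Int.floor_le_floor
      push_cast
      exact h2.2
  have hfl : ∀ (m : ℕ) (x : ℝ), |(⌊2 ^ m * x⌋ : ℝ) / 2 ^ m - x| ≤ 1 / 2 ^ m := by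
    intro m x
    have hm : (0 : ℝ) < 2 ^ m := by positivity
    have h1 := Int.floor_le (2 ^ m * x)
    have h2 := Int.lt_floor_add_one (2 ^ m * x)
    have : (⌊2 ^ m * x⌋ : ℝ) / 2 ^ m - x = (⌊2 ^ m * x⌋ - 2 ^ m * x) / 2 ^ m := by field_simp
    rw [this, abs_div, abs_of_pos hm, div_le_div_iff_of_pos_right hm, abs_le]
    constructor <;> linarith
  obtain ⟨c, hc⟩ := exists_nat_ge (L + 3)
  have hdata : TraceData F C L (fun m => gridSet R (Q m) m) ℓ c k a := by
    refine ⟨hF, fun m z hz => ?_, fun m g hg => ?_, fun m => (hℓL m).1, fun m => (hℓL m).2, hc,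
      hst, hend⟩
    · refine ⟨hbox m z hz 0, hbox m z hz 1, ?_⟩
      obtain ⟨U, hU, hzU⟩ : ∃ U ∈ Q m, z ∈ NbhdCode.toSet U := by
        simpa [coverUnion] using (hQn m).2.1 hz
      obtain ⟨h0, h1⟩ : |z 0 - U.1.1.val| < U.2.val ∧ |z 1 - U.1.2.val| < U.2.val := hzU
      refine ⟨U, hU, ?_, ?_⟩
      · rw [near_coord_iff]
        have hz0 : |((latticeFloor m z).1 : ℝ) / 2 ^ m - z 0| ≤ 1 / 2 ^ m := hfl m (z 0)
        exact (abs_sub_le _ (z 0) _).trans_lt (by linarith)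
      · rw [near_coord_iff]
        have hz1 : |((latticeFloor m z).2 : ℝ) / 2 ^ m - z 1| ≤ 1 / 2 ^ m := hfl m (z 1)
        exact (abs_sub_le _ (z 1) _).trans_lt (by linarith)
    · have hm : (0 : ℝ) < 2 ^ m := by positivity
      obtain ⟨-, -, U, hU, h0, h1⟩ := hg
      rw [near_coord_iff] at h0 h1
      have hr := (hQn m).1 U hU
      obtain ⟨w0, hw0, hxw0⟩ := exists_between_of_abs_sub_lt hr (by positivity) h0
      obtain ⟨w1, hw1, hxw1⟩ := exists_between_of_abs_sub_lt hr (by positivity) h1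
      have hw : !₂[w0, w1] ∈ coverUnion (Q m) := by
        simp only [coverUnion, mem_iUnion]
        exact ⟨U, hU, hw0, hw1⟩
      obtain ⟨z, hz, hz0, hz1⟩ := exists_mem_of_dH_lt (hQn m).2.2 hw
      rw [one_div, inv_pow, ← one_div] at hz0 hz1
      -- The `2` in `near`: one mesh to reach the cover, one more from the Hausdorff distance.
      have key : ∀ x v y : ℝ, |x / 2 ^ m - v| ≤ 1 / 2 ^ m → |v - y| < 1 / 2 ^ m →
          |x - 2 ^ m * y| ≤ 2 := by
        intro x v y h1 h2
        have h3 : |x / 2 ^ m - y| ≤ 2 / 2 ^ m := by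
          refine (abs_sub_le _ v _).trans ?_
          rw [show (2 : ℝ) / 2 ^ m = 1 / 2 ^ m + 1 / 2 ^ m by ring]
          exact add_le_add h1 h2.le
        have h4 : x - 2 ^ m * y = (x / 2 ^ m - y) * 2 ^ m := by field_simp
        rw [h4, abs_mul, abs_of_pos hm]
        exact (le_div_iff₀ hm).1 h3
      exact ⟨z, hz, key _ _ _ hxw0 hz0, key _ _ _ hxw1 hz1⟩
  exact hdata.isComputablePath hQ hℓ

/-! ### From computable paths to compact covers -/

/-- A computable function with optional values is the limit of a primitive recursive sequence of
finite approximations. -/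
theorem exists_primrec_approx {α β : Type*} [Primcodable α] [Primcodable β] {f : α → Option β}
    (hf : Computable f) : ∃ g : ℕ → α → Option β, Primrec₂ g ∧
      (∀ k a b, g k a = some b → f a = some b) ∧
      ∀ a b, f a = some b → ∃ k, ∀ K ≥ k, g K a = some b := by
  -- The value `none` is turned into divergence; running the code with step bound `k` then produces
  -- only true answers, each of which persists.
  obtain ⟨c, hc⟩ := Nat.Partrec.Code.exists_code.1 hf.ofOption
  have hev : ∀ a x, x ∈ c.eval (Encodable.encode a) ↔ ∃ b, f a = some b ∧ Encodable.encode b = x := by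
    intro a x
    rw [hc]
    simp
  refine ⟨fun k a => (c.evaln k (Encodable.encode a)).bind Encodable.decode, ?_, fun k a b h => ?_,
    fun a b h => ?_⟩
  · refine Primrec.option_bind (f := fun q : ℕ × α => c.evaln q.1 (Encodable.encode q.2)) ?_
      (Primrec.decode.comp Primrec.snd)
    exact Nat.Partrec.Code.primrec_evaln.comp (Primrec.pair (Primrec.pair Primrec.fst
      (Primrec.const c)) (Primrec.encode.comp Primrec.snd))
  · obtain ⟨x, hx, hxb⟩ := Option.bind_eq_some_iff.1 h
    obtain ⟨b', hb', rfl⟩ := (hev a x).1 (Nat.Partrec.Code.evaln_sound hx)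
    rw [Encodable.encodek] at hxb
    rw [hb', hxb]
  · obtain ⟨k, hk⟩ := Nat.Partrec.Code.evaln_complete.1 ((hev a _).2 ⟨b, h, rfl⟩)
    refine ⟨k, fun K hK => ?_⟩
    have := Nat.Partrec.Code.evaln_mono hK hk
    simp only [Option.mem_def] at this
    simp only [this, Option.bind_some, Encodable.encodek]

theorem val_dyadic (u i : ℕ) : RatCode.val ((u : ℤ), 2 ^ i - 1) = (u : ℝ) / 2 ^ i := by
  have : ((2 ^ i - 1 : ℕ) : ℝ) + 1 = 2 ^ i := by
    rw [Nat.cast_sub Nat.one_le_two_pow]; push_cast; ring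
  rw [RatCode.val, this, Int.cast_natCast]

/-- The first `k` terms of the name of `j / 2 ^ K` that consists of lower dyadic approximations. -/
def dyadicPrefix (K j k : ℕ) : List RatCode :=
  (List.range k).map fun i => (((j / 2 ^ (K - i) : ℕ) : ℤ), 2 ^ i - 1)

/-- The name of `x` that consists of lower dyadic approximations. -/
def dyadicName (x : ℝ) (i : ℕ) : RatCode := ((⌊x * 2 ^ i⌋₊ : ℤ), 2 ^ i - 1)

theorem isName_dyadicName (x : I) : IsName (dyadicName x) x := by
  have h : ∀ i : ℕ, (dyadicName x i).val ≤ x ∧ x ≤ (dyadicName x i).val + 1 / 2 ^ i := by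
    intro i
    have hi : (0 : ℝ) < 2 ^ i := by positivity
    have h1 := Nat.floor_le (mul_nonneg x.2.1 hi.le)
    have h2 := Nat.lt_floor_add_one ((x : ℝ) * 2 ^ i)
    rw [dyadicName, val_dyadic]
    constructor
    · rwa [div_le_iff₀ hi]
    · rw [← add_div, le_div_iff₀ hi]; exact h2.le
  constructor
  · intro n
    have h3 : (1 : ℝ) / 2 ^ (n + 1) ≤ 1 / 2 ^ n := by
      gcongr
      · norm_num
      · omega
    rw [div_pow, one_pow, abs_le]
    have h1 := h n
    have h2 := h (n + 1)
    constructor <;> linarith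
  · rw [tendsto_iff_dist_tendsto_zero]
    refine squeeze_zero (fun _ => dist_nonneg) (fun n => ?_) (tendsto_const_div_two_pow le_rfl 1)
    rw [Real.dist_eq, abs_le]
    have h1 := h n
    have : (0 : ℝ) ≤ 1 / 2 ^ n := by positivity
    constructor <;> linarith

/-- Dropping the last binary digits of `⌊x * 2 ^ K⌋₊` gives `⌊x * 2 ^ i⌋₊`. So one integer below `2
^ K + 1` represents all `x` with this prefix. -/
theorem dyadicPrefix_floor (x : ℝ) {K k : ℕ} (hk : k ≤ K) :
    dyadicPrefix K ⌊x * 2 ^ K⌋₊ k = (List.range k).map (dyadicName x) := by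
  refine List.map_congr_left fun i hi => ?_
  have hi : i < k := List.mem_range.1 hi
  have h1 : (2 : ℝ) ^ K = 2 ^ i * 2 ^ (K - i) := by rw [← pow_add]; congr 1; omega
  have h2 := Nat.floor_div_natCast (x * 2 ^ K) (2 ^ (K - i))
  rw [dyadicName, ← h2, h1]
  push_cast
  rw [← mul_assoc, mul_div_assoc, div_self (by positivity), mul_one]

/-- All names made of lower dyadic approximations are processed by a machine within a bounded
number of steps. -/
theorem eventually_exists_isSome {g : I → ℝ} {M : List RatCode → ℕ → Option RatCode}
    (hM : ∀ (x : I) (φ : ℕ → RatCode), IsName φ (x : ℝ) →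
      ∃ ψ : ℕ → RatCode, IsName ψ (g x) ∧ Transfers M φ ψ)
    {A : ℕ → List RatCode × ℕ → Option RatCode}
    (hA : ∀ w q, M w.1 w.2 = some q → ∃ k, ∀ K ≥ k, A K w = some q) (n : ℕ) :
    ∀ᶠ K in atTop, ∀ j < 2 ^ K + 1, ∃ k < K + 1, (A K (dyadicPrefix K j k, n)).isSome := by
  by_contra hcon
  rw [not_eventually] at hcon
  set B : Set ℕ := {K | ¬ ∀ j < 2 ^ K + 1, ∃ k < K + 1, (A K (dyadicPrefix K j k, n)).isSome} with hB
  have hne : NeBot (atTop ⊓ 𝓟 B) := frequently_mem_iff_neBot.1 hcon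
  set 𝒰 := Ultrafilter.of (atTop ⊓ 𝓟 B)
  have hle := Ultrafilter.of_le (atTop ⊓ 𝓟 B)
  have h𝒰 : (𝒰 : Filter ℕ) ≤ atTop := hle.trans inf_le_left
  have hBU : ∀ᶠ K in 𝒰, K ∈ B := le_principal_iff.1 (hle.trans inf_le_right)
  have hex : ∀ K, ∃ j, j < 2 ^ K + 1 ∧ (K ∈ B → ∀ k < K + 1, A K (dyadicPrefix K j k, n) = none) := by
    intro K
    by_cases hK : K ∈ B
    · simp only [hB, mem_ofPred_eq] at hK
      push Not at hK
      obtain ⟨j, hj, h⟩ := hK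
      exact ⟨j, hj, fun _ k hk => by simpa using h k hk⟩
    · exact ⟨0, Nat.succ_pos _, fun h => absurd h hK⟩
  choose j hj hjB using hex
  -- As in König's lemma: each truncation of `j K` has finitely many possible values, so the
  -- ultrafilter selects one.
  have hu : ∀ i, ∃ u ≤ 2 ^ i, ∀ᶠ K in 𝒰, j K / 2 ^ (K - i) = u := by
    intro i
    obtain ⟨u, hu, hle⟩ := (Set.finite_Iic (2 ^ i)).isCompact.ultrafilter_le_nhds
      (𝒰.map fun K => j K / 2 ^ (K - i)) (by
        rw [Ultrafilter.coe_map, le_principal_iff, mem_map]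
        filter_upwards [h𝒰 (eventually_ge_atTop i)] with K hK
        have h1 := hj K
        have h2 : 2 ^ K = 2 ^ i * 2 ^ (K - i) := by rw [← pow_add]; congr 1; omega
        refine (Nat.div_le_div_right (Nat.lt_succ_iff.1 h1)).trans ?_
        rw [h2, Nat.mul_div_cancel _ (by positivity)])
    refine ⟨u, hu, ?_⟩
    rw [nhds_discrete] at hle
    exact hle (mem_pure.2 rfl : {u} ∈ (pure u : Filter ℕ))
  choose u hule hu using hu
  have hstep : ∀ i, u (i + 1) / 2 = u i := by
    intro i
    obtain ⟨K, h1, h2, h3⟩ := ((hu i).and ((hu (i + 1)).and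
      (h𝒰 (eventually_ge_atTop (i + 1))))).exists
    rw [← h1, ← h2, Nat.div_div_eq_div_mul, ← pow_succ]
    congr 2
    omega
  -- The selected branch is a name of some `x`, but perhaps not `dyadicName x`: its binary digits
  -- may end in ones. Hence the machine must be correct on every name.
  let φ : ℕ → RatCode := fun i => ((u i : ℤ), 2 ^ i - 1)
  have hval : ∀ i, (φ i).val = (u i : ℝ) / 2 ^ i := fun i => val_dyadic _ _
  have hd : ∀ i, |(φ i).val - (φ (i + 1)).val| ≤ 1 / 2 ^ (i + 1) := by
    intro i
    rw [hval, hval]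
    have h1 : 2 * u i ≤ u (i + 1) ∧ u (i + 1) ≤ 2 * u i + 1 := by
      have := hstep i; omega
    have h2 : (2 * u i : ℝ) ≤ u (i + 1) := by exact_mod_cast h1.1
    have h3 : (u (i + 1) : ℝ) ≤ 2 * u i + 1 := by exact_mod_cast h1.2
    have h4 : (u i : ℝ) / 2 ^ i - u (i + 1) / 2 ^ (i + 1) = (2 * u i - u (i + 1)) / 2 ^ (i + 1) := by
      rw [pow_succ]; field_simp
    rw [h4, abs_div, abs_of_pos (by positivity : (0 : ℝ) < 2 ^ (i + 1))]
    gcongr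
    rw [abs_le]
    constructor <;> linarith
  have hcau : CauchySeq fun i => (φ i).val :=
    cauchySeq_of_le_geometric_two (C := 1) fun i => by
      rw [Real.dist_eq]
      refine (hd i).trans_eq ?_
      rw [pow_succ]; field_simp
  obtain ⟨x, hx⟩ := cauchySeq_tendsto_of_complete hcau
  have hxI : x ∈ Icc (0 : ℝ) 1 := by
    refine isClosed_Icc.mem_of_tendsto hx (Eventually.of_forall fun i => ?_)
    rw [hval]
    exact ⟨by positivity, (div_le_one (by positivity)).2 (by exact_mod_cast hule i)⟩
  have hname : IsName φ x := ⟨fun i => (hd i).trans (by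
    rw [div_pow, one_pow]
    gcongr
    · norm_num
    · omega), hx⟩
  obtain ⟨ψ, -, hψ⟩ := hM ⟨x, hxI⟩ φ hname
  obtain ⟨k, hk⟩ := (hψ n).1
  obtain ⟨K0, hK0⟩ := hA ((List.range k).map φ, n) _ hk
  have hall : ∀ᶠ K in 𝒰, ∀ i ∈ Finset.range k, j K / 2 ^ (K - i) = u i :=
    (Filter.eventually_all_finset _).2 fun i _ => hu i
  have hge : ∀ b, ∀ᶠ K in (𝒰 : Filter ℕ), b ≤ K := fun b => h𝒰 (eventually_ge_atTop b)
  -- The machine answers on a prefix of `φ`, which for such `K` is also the prefix given by `j K`,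
  -- contradicting the choice of `j K`.
  obtain ⟨K, hK1, hK2, hK3, hKB⟩ := (hall.and ((hge K0).and ((hge k).and hBU))).exists
  have hpre : dyadicPrefix K (j K) k = (List.range k).map φ :=
    List.map_congr_left fun i hi => by
      simp only [φ, hK1 i (Finset.mem_range.2 (List.mem_range.1 hi))]
  have h1 := hjB K hKB k (by omega)
  rw [hpre, hK0 K hK2] at h1
  exact absurd h1 (by simp)

/-- The first answer that a machine gives on prefixes of length at most `K` of the dyadic name of
`j / 2 ^ K`. -/
def firstAnswer (A : ℕ → List RatCode × ℕ → Option RatCode) (n K j : ℕ) : RatCode :=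
  (((List.range (K + 1)).filterMap fun k => A K (dyadicPrefix K j k, n)).head?).getD (0, 0)

theorem exists_firstAnswer {A : ℕ → List RatCode × ℕ → Option RatCode} {n K j : ℕ}
    (h : ∃ k < K + 1, (A K (dyadicPrefix K j k, n)).isSome) :
    ∃ k ≤ K, A K (dyadicPrefix K j k, n) = some (firstAnswer A n K j) := by
  obtain ⟨k, hk, hs⟩ := h
  obtain ⟨q, hq⟩ := Option.isSome_iff_exists.1 hs
  set l := (List.range (K + 1)).filterMap fun k => A K (dyadicPrefix K j k, n) with hl
  have hmem : q ∈ l := List.mem_filterMap.2 ⟨k, List.mem_range.2 hk, hq⟩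
  have hne : l ≠ [] := List.ne_nil_of_mem hmem
  have h1 : firstAnswer A n K j = l.head hne := by
    rw [firstAnswer, ← hl, List.head?_eq_some_head hne, Option.getD_some]
  have h2 : firstAnswer A n K j ∈ l := h1 ▸ List.head_mem hne
  obtain ⟨k', hk', hq'⟩ := List.mem_filterMap.1 h2
  exact ⟨k', by have := List.mem_range.1 hk'; omega, hq'⟩

theorem abs_firstAnswer_sub_le {g : I → ℝ} {M : List RatCode → ℕ → Option RatCode}
    (hM : ∀ (x : I) (φ : ℕ → RatCode), IsName φ (x : ℝ) →
      ∃ ψ : ℕ → RatCode, IsName ψ (g x) ∧ Transfers M φ ψ)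
    {A : ℕ → List RatCode × ℕ → Option RatCode}
    (hA : ∀ K w q, A K w = some q → M w.1 w.2 = some q) {n K : ℕ} (x : I)
    (h : ∃ k < K + 1, (A K (dyadicPrefix K ⌊(x : ℝ) * 2 ^ K⌋₊ k, n)).isSome) :
    |(firstAnswer A n K ⌊(x : ℝ) * 2 ^ K⌋₊).val - g x| ≤ 2 / 2 ^ n := by
  obtain ⟨k, hk, hq⟩ := exists_firstAnswer h
  obtain ⟨ψ, hψ, hT⟩ := hM x _ (isName_dyadicName x)
  have h1 := hA _ _ _ hq
  rw [dyadicPrefix_floor _ hk] at h1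
  rw [(hT n).2 _ _ h1]
  exact hψ.abs_sub_le n

section

variable {α : Type*} [Primcodable α]

@[fun_prop]
theorem primrec_dyadicPrefix {K j k : α → ℕ} (hK : Primrec K) (hj : Primrec j) (hk : Primrec k) :
    Primrec fun a => dyadicPrefix (K a) (j a) (k a) :=
  Primrec.list_map (Primrec.list_range.comp hk) (by unfold Primrec₂; fun_prop)

theorem primrec_firstAnswer {A : ℕ → List RatCode × ℕ → Option RatCode} (hA : Primrec₂ A)
    {n K j : α → ℕ} (hn : Primrec n) (hK : Primrec K) (hj : Primrec j) :
    Primrec fun a => firstAnswer A (n a) (K a) (j a) := by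
  have h : Primrec fun q : α × ℕ => A (K q.1) (dyadicPrefix (K q.1) (j q.1) q.2, n q.1) :=
    hA.comp (by fun_prop) (by fun_prop)
  exact Primrec.option_getD.comp (Primrec.list_head?.comp (Primrec.listFilterMap
    (Primrec.list_range.comp (Primrec.succ.comp hK)) h)) (Primrec.const _)

theorem primrecPred_forall_exists_isSome {A : ℕ → List RatCode × ℕ → Option RatCode}
    (hA : Primrec₂ A) : PrimrecPred fun q : ℕ × ℕ =>
      ∀ j < 2 ^ q.2 + 1, ∃ k < q.2 + 1, (A q.2 (dyadicPrefix q.2 j k, q.1)).isSome := by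
  refine PrimrecPred.forall_lt' (by fun_prop) (PrimrecPred.exists_lt' (by fun_prop) ?_)
  have h : Primrec fun q : ((ℕ × ℕ) × ℕ) × ℕ =>
      A q.1.1.2 (dyadicPrefix q.1.1.2 q.1.2 q.2, q.1.1.1) :=
    hA.comp (by fun_prop) (by fun_prop)
  exact Primrec.eq.comp (Primrec.option_isSome.comp h) (Primrec.const true)

end

theorem RComputable.kComputable {C : Set Plane} (h : RComputable C) : KComputable C := by
  obtain ⟨f, hf, rfl⟩ := h
  obtain ⟨M, hMc, hM⟩ := hf 0
  obtain ⟨M', hMc', hM'⟩ := hf 1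
  obtain ⟨A, hA, hAM, hMA⟩ := exists_primrec_approx hMc
  obtain ⟨A', hA', hAM', hMA'⟩ := exists_primrec_approx hMc'
  obtain ⟨s, hs, hsP⟩ := exists_computable_choice (p := fun q : ℕ × ℕ =>
      (∀ j < 2 ^ q.2 + 1, ∃ k < q.2 + 1, (A q.2 (dyadicPrefix q.2 j k, q.1)).isSome) ∧
      ∀ j < 2 ^ q.2 + 1, ∃ k < q.2 + 1, (A' q.2 (dyadicPrefix q.2 j k, q.1)).isSome)
    -- Output term `n + 4` has error at most `2 / 2 ^ (n + 4)`, less than the square size `1 / 2 ^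
    -- (n + 2)`; two such sizes make `1 / 2 ^ (n + 1)`, strictly below `2 ^ (-n)`.
    (f := fun n K => (n + 4, K))
    ((primrecPred_forall_exists_isSome hA).and (primrecPred_forall_exists_isSome hA'))
    ((by fun_prop : Primrec fun q : ℕ × ℕ => (q.1 + 4, q.2)).to_comp)
    (fun n => ((eventually_exists_isSome hM hMA (n + 4)).and
      (eventually_exists_isSome hM' hMA' (n + 4))).exists)
  let U : ℕ → ℕ → ℕ → NbhdCode := fun n K j =>
    ((firstAnswer A (n + 4) K j, firstAnswer A' (n + 4) K j), ((1 : ℕ), 2 ^ (n + 2) - 1))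
  have hUr : ∀ n K j, RatCode.val (U n K j).2 = 1 / 2 ^ (n + 2) := fun n K j => by
    simp only [U]
    rw [val_dyadic, Nat.cast_one]
  have hlist : Primrec fun q : ℕ × ℕ => (List.range (2 ^ q.2 + 1)).map (U q.1 q.2) := by
    refine Primrec.list_map (Primrec.list_range.comp (by fun_prop)) ?_
    refine Primrec.pair (Primrec.pair ?_ ?_) (by fun_prop)
    · exact primrec_firstAnswer hA (by fun_prop) (by fun_prop) (by fun_prop)
    · exact primrec_firstAnswer hA' (by fun_prop) (by fun_prop) (by fun_prop)
  have hfl : ∀ (K : ℕ) (x : I), ⌊(x : ℝ) * 2 ^ K⌋₊ < 2 ^ K + 1 := fun K x => by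
    rw [Nat.lt_succ_iff]
    apply Nat.floor_le_of_le
    push_cast
    exact mul_le_of_le_one_left (by positivity) x.2.2
  have happ : ∀ (n : ℕ) (x : I), f x ∈ nbhd (1 / 2 ^ (n + 2))
      !₂[(U n (s n) ⌊(x : ℝ) * 2 ^ s n⌋₊).1.1.val, (U n (s n) ⌊(x : ℝ) * 2 ^ s n⌋₊).1.2.val] := by
    intro n x
    have h1 := abs_firstAnswer_sub_le hM hAM x ((hsP n).1 _ (hfl _ x))
    have h2 := abs_firstAnswer_sub_le hM' hAM' x ((hsP n).2 _ (hfl _ x))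
    have h3 : (2 : ℝ) / 2 ^ (n + 4) < 1 / 2 ^ (n + 2) := by
      rw [div_lt_div_iff₀ (by positivity) (by positivity), pow_add, pow_add]
      have : (0 : ℝ) < 2 ^ n := by positivity
      nlinarith
    rw [abs_sub_comm] at h1 h2
    exact ⟨h1.trans_lt h3, h2.trans_lt h3⟩
  have hcov : ∀ n, range f ⊆ coverUnion ((List.range (2 ^ s n + 1)).map (U n (s n))) := by
    rintro n _ ⟨x, rfl⟩
    simp only [coverUnion, mem_iUnion]
    refine ⟨_, List.mem_map.2 ⟨_, List.mem_range.2 (hfl _ x), rfl⟩, ?_⟩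
    rw [NbhdCode.toSet, hUr]
    exact happ n x
  refine ⟨fun n => (List.range (2 ^ s n + 1)).map (U n (s n)),
    (hlist.to_comp.comp (Computable.pair Computable.id hs) :), fun n => ⟨?_, ?_, ?_⟩⟩
  · intro V hV
    obtain ⟨j, -, rfl⟩ := List.mem_map.1 hV
    rw [hUr]; positivity
  · exact hcov n
  · have h2r : (1 : ℝ) / 2 ^ (n + 1) = 1 / 2 ^ (n + 2) + 1 / 2 ^ (n + 2) := by
      rw [pow_succ _ (n + 1)]; field_simp; norm_num
    refine lt_of_le_of_lt (b := ENNReal.ofReal (1 / 2 ^ (n + 1)))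
      (iInf₂_le _ ⟨by positivity, ?_, ?_⟩) ((ENNReal.ofReal_lt_ofReal_iff (by positivity)).2 ?_)
    · rw [div_pow, one_pow]
      gcongr
      · norm_num
      · omega
    · intro w hw
      simp only [coverUnion, mem_iUnion] at hw
      obtain ⟨V, hV, hwV⟩ := hw
      obtain ⟨j, hj, rfl⟩ := List.mem_map.1 hV
      have hj := List.mem_range.1 hj
      have hfx := happ n (grid (s n) j)
      -- Every index `j` is the floor belonging to the grid point `j / 2 ^ s n`, so no square of the
      -- list is far from the curve.
      rw [coe_grid (by omega), div_mul_cancel₀ _ (by positivity), Nat.floor_natCast] at hfx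
      rw [NbhdCode.toSet, hUr] at hwV
      simp only [nbhdSet, mem_iUnion]
      refine ⟨f (grid (s n) j), ⟨_, rfl⟩, ?_⟩
      have key : ∀ {x y u : ℝ}, |x - u| < 1 / 2 ^ (n + 2) → |y - u| < 1 / 2 ^ (n + 2) →
          |x - y| < 1 / 2 ^ (n + 1) := by
        intro x y u hx hy
        rw [abs_sub_comm] at hy
        rw [h2r]
        exact (abs_sub_le _ u _).trans_lt (add_lt_add hx hy)
      exact ⟨key hwV.1 hfx.1, key hwV.2 hfx.2⟩
    · rintro _ ⟨x, rfl⟩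
      simp only [nbhdSet, mem_iUnion]
      exact ⟨f x, hcov n ⟨x, rfl⟩, by simp [nbhd]⟩

end CompCurve

end


/-! ### The equivalence -/

theorem corollary2p5 (C : Set CompCurve.Plane)
    (hsimple : CompCurve.IsSimpleCurve C)
    (hrect : CompCurve.IsRectifiable C)
    (hlen : CompCurve.IsComputableReal (CompCurve.curveLength C).toReal) :
    [CompCurve.KComputable C, CompCurve.RComputable C,
      CompCurve.MComputable C, CompCurve.NComputable C].TFAE := by
  obtain ⟨F, hF⟩ := CompCurve.exists_isArcParam hsimple hrect
  tfae_have 1 → 3 := fun h => ⟨F, h.isComputablePath hF hlen, hF.inj.2.1, hF.inj.2.2⟩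
  tfae_have 1 → 4 := fun h =>
    ⟨hrect, F, h.isComputablePath hF hlen, hF.inj.2.2, hF.curveLength_image_Iic⟩
  tfae_have 3 → 2 := fun ⟨f, hf, _, hr⟩ => ⟨f, hf, hr⟩
  tfae_have 4 → 2 := fun ⟨_, f, hf, hr, _⟩ => ⟨f, hf, hr⟩
  tfae_have 2 → 1 := CompCurve.RComputable.kComputable
  tfae_finish
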